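/- For a positive integer $m$ write $e_m(z)=e^{2\pi i z/m}$, and for an integer $x$ coprime to $m$ let $x^*$ denote its multiplicative inverse modulo $m$. For every $\varepsilon>0$ there is $\delta=\delta(\varepsilon)>0$ such that the following holds. Let $m\ge 2$ be an integer and let $N_1,N_2\ge m^{\varepsilon}$ be integers such that, for $i=1$ or $i=2$, $$N_i\notin\bigcup_{j\ge 1}\left[m^{\frac1{2j}-\varepsilon},\,m^{\frac1{2j}+\varepsilon}\right].$$ Then for all complex numbers $\alpha_1(x)$ $(1\le x\le N_1)$ and $\alpha_2(x)$ $(1\le x\le N_2)$ of absolute value at most $1$, $$\max_{(a,m)=1}\left|\sum_{\substack{x_1=1\\ (x_1,m)=1}}^{N_1}\ \sum_{\substack{x_2=1\\ (x_2,m)=1}}^{N_2}\alpha_1(x_1)\,\alpha_2(x_2)\,e_m(a x_1^*x_2^*)\right|<m^{-\delta}N_1N_2 .$$ -/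

import Mathlib

noncomputable section

/-- The additive character `e_m(z) = exp(2 π i z / m)` at an integer `z`. -/
def eMod (m : ℕ) (z : ℤ) : ℂ :=
  Complex.exp (2 * Real.pi * Complex.I * (z : ℂ) / (m : ℂ))

/-- `x^*`: the representative in `[0, m - 1]` of the multiplicative inverse of `x` modulo `m`
(only used when `x` is coprime to `m`). -/
def recip (m : ℕ) (x : ℕ) : ℤ :=
  (((x : ZMod m)⁻¹).val : ℤ)

/-- The bilinear Kloosterman sum over `[1, N₁] × [1, N₂]`; both variables of summation are
restricted to integers coprime to `m`. -/
def bilinearKloosterman (m : ℕ) (a : ℤ) (α₁ α₂ : ℕ → ℂ) (N₁ N₂ : ℕ) : ℂ :=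
  ∑ x₁ ∈ (Finset.Icc 1 N₁).filter (fun x => Nat.Coprime x m),
    ∑ x₂ ∈ (Finset.Icc 1 N₂).filter (fun x => Nat.Coprime x m),
      α₁ x₁ * α₂ x₂ * eMod m (a * recip m x₁ * recip m x₂)

/-- The union over `j ≥ 1` of the windows `[m^(1/(2j) - ε), m^(1/(2j) + ε)]`. -/
def criticalWindows (m : ℕ) (ε : ℝ) : Set ℝ :=
  ⋃ j : ℕ, ⋃ _ : 1 ≤ j,
    Set.Icc ((m : ℝ) ^ (1 / (2 * (j : ℝ)) - ε)) ((m : ℝ) ^ (1 / (2 * (j : ℝ)) + ε))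

end

/-!
Let `E_k(N)` be the number of solutions modulo `m` of `1/x₁ + ⋯ + 1/x_k = 1/y₁ + ⋯ + 1/y_k` in
integers of `[M, N]` coprime to `m`. Hölder's inequality twice and orthogonality of additive
characters give, for `k₁, k₂ ≥ 1`,
`|S| ^ (2 k₁ k₂) ≤ N₁ ^ (2 k₁ (k₂ - 1)) N₂ ^ (2 k₂ (k₁ - 1)) m E_{k₁}(N₁) E_{k₂}(N₂)`,
so a power is saved once `√m E_k(N) ≪ N ^ (2 k) m ^ (o(1))` for both lengths, with a power of `m`
to spare for one of them.

Over the rationals the same equation has `≪ N ^ (k + o(1))` solutions: clearing denominators shows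
that a prime dividing `∏ xᵢ yᵢ` divides it twice, so the product is `a b²` with `a ∣ b` and
`b ≤ N ^ k`, and the divisor bound counts the unknowns. The sums `1/x₁ + ⋯ + 1/x_k` in a fixed class
modulo `m` lie in `[0, k / M]` and are `m / N ^ (2 k)`-separated, because the cleared numerator of
the difference of two of them is a nonzero multiple of `m`; hence
`E_k(N) ≪ (N ^ (2 k) / (M m) + 1) N ^ (k + o(1))`. With `M = N m ^ (-η)` and
`N ^ (k - 1) ≤ √m < N ^ k` this is what is needed, and there is a power of `m` to spare when `N`
avoids the windows around `m ^ (1 / (2 k))` and, for `k > 1`, around `m ^ (1 / (2 (k - 1)))`.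

The constant in the resulting bound `C m ^ (-c) N₁ N₂` matters only for boundedly many `m`. For
each of those a fixed proportion is saved in every `2 × 2` block of consecutive integers: either one
of the four terms vanishes, or the mixed second difference of `a / (x y)` over the block is the
unit `a / (x (x + 1) y (y + 1))` of `ZMod m`, so that, the weights being a product, the four terms
cannot all have the same direction.
-/

open Finset
open scoped Topology

lemma add_one_le_mul_rpow {η : ℝ} (hη : 0 < η) (a : ℕ) :
    (a : ℝ) + 1 ≤ (1 + 1 / (η * Real.log 2)) * (2 : ℝ) ^ ((a : ℝ) * η) := by
  have hexp : (a : ℝ) * η * Real.log 2 + 1 ≤ (2 : ℝ) ^ ((a : ℝ) * η) := by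
    rw [Real.rpow_def_of_pos two_pos]
    linarith [Real.add_one_le_exp (Real.log 2 * (a * η))]
  have hnonneg : 0 ≤ a * (η * Real.log 2) + 1 / (η * Real.log 2) := by positivity
  calc (a : ℝ) + 1
      ≤ a + 1 + (a * (η * Real.log 2) + 1 / (η * Real.log 2)) := le_add_of_nonneg_right hnonneg
    _ = (1 + 1 / (η * Real.log 2)) * ((a : ℝ) * η * Real.log 2 + 1) := by
        field_simp
        ring
    _ ≤ (1 + 1 / (η * Real.log 2)) * (2 : ℝ) ^ ((a : ℝ) * η) := by gcongr

lemma add_one_le_rpow_of_two_le_rpow {η x : ℝ} (hx : 0 ≤ x) (h : 2 ≤ x ^ η) (a : ℕ) :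
    (a : ℝ) + 1 ≤ x ^ ((a : ℝ) * η) := by
  rw [mul_comm, Real.rpow_mul hx, Real.rpow_natCast]
  calc (a : ℝ) + 1 ≤ 2 ^ a := by exact_mod_cast Nat.lt_two_pow_self
    _ ≤ (x ^ η) ^ a := by gcongr

lemma natCast_rpow_eq_prod_primeFactors {n : ℕ} (hn : n ≠ 0) (η : ℝ) :
    (n : ℝ) ^ η = ∏ p ∈ n.primeFactors, (p : ℝ) ^ ((n.factorization p : ℝ) * η) := by
  conv_lhs => rw [← Nat.prod_factorization_pow_eq_self hn]
  rw [Finsupp.prod, Nat.support_factorization, Nat.cast_prod,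
    ← Real.finsetProd_rpow _ _ fun _ _ => Nat.cast_nonneg _]
  refine prod_congr rfl fun p _ => ?_
  rw [Nat.cast_pow, ← Real.rpow_natCast, ← Real.rpow_mul p.cast_nonneg]

theorem exists_card_divisors_le {η : ℝ} (hη : 0 < η) :
    ∃ C : ℝ, 1 ≤ C ∧ ∀ n : ℕ, n ≠ 0 → (#n.divisors : ℝ) ≤ C * (n : ℝ) ^ η := by
  set c : ℝ := 1 + 1 / (η * Real.log 2)
  have hc : 1 ≤ c := le_add_of_nonneg_right (by positivity)
  set P : ℕ := ⌈(2 : ℝ) ^ (1 / η)⌉₊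
  refine ⟨c ^ P, one_le_pow₀ hc, fun n hn => ?_⟩
  have hfactor : ∀ p ∈ n.primeFactors, (n.factorization p : ℝ) + 1
      ≤ (if p < P then c else 1) * (p : ℝ) ^ ((n.factorization p : ℝ) * η) := fun p hp => by
    split_ifs with hpP
    · have htwo : (2 : ℝ) ≤ p := by exact_mod_cast (Nat.prime_of_mem_primeFactors hp).two_le
      refine (add_one_le_mul_rpow hη _).trans ?_
      gcongr
    · rw [one_mul]
      refine add_one_le_rpow_of_two_le_rpow p.cast_nonneg ?_ _
      calc (2 : ℝ) = ((2 : ℝ) ^ (1 / η)) ^ η := by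
            rw [← Real.rpow_mul two_pos.le, one_div_mul_cancel hη.ne', Real.rpow_one]
        _ ≤ (p : ℝ) ^ η := by
            gcongr
            exact Nat.ceil_le.mp (not_lt.mp hpP)
  calc (#n.divisors : ℝ) = ∏ p ∈ n.primeFactors, ((n.factorization p : ℝ) + 1) := by
        rw [Nat.card_divisors hn]
        push_cast
        rfl
    _ ≤ ∏ p ∈ n.primeFactors,
          (if p < P then c else 1) * (p : ℝ) ^ ((n.factorization p : ℝ) * η) :=
        prod_le_prod (fun _ _ => by positivity) hfactor
    _ = c ^ #{p ∈ n.primeFactors | p < P} * (n : ℝ) ^ η := by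
        rw [prod_mul_distrib, natCast_rpow_eq_prod_primeFactors hn, ← prod_filter, prod_const]
    _ ≤ c ^ P * (n : ℝ) ^ η := by
        gcongr
        calc #{p ∈ n.primeFactors | p < P} ≤ #(range P) :=
              card_le_card fun p hp => mem_range.mpr (mem_filter.mp hp).2
          _ = P := card_range P

/-- The numerator of `∑ i, σ i / z i` over the common denominator `∏ i, z i`. It stays an integer
so that the same numerator can be read in `ℚ` and in `ZMod m`. -/
def clearedSum {ι : Type*} [Fintype ι] [DecidableEq ι] (σ : ι → ℤ) (z : ι → ℕ) : ℤ :=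
  ∑ i, σ i * ∏ j ∈ univ.erase i, (z j : ℤ)

section ClearedSum

variable {ι : Type*} [Fintype ι] {σ : ι → ℤ} {z : ι → ℕ}

lemma prod_mul_sum_eq_clearedSum [DecidableEq ι] {R : Type*} [CommRing R] {r : ι → R}
    (hr : ∀ i, (z i : R) * r i = 1) :
    (∏ i, (z i : R)) * ∑ i, σ i * r i = clearedSum σ z := by
  rw [clearedSum, mul_sum]
  push_cast
  refine sum_congr rfl fun i _ => ?_
  rw [← mul_prod_erase univ (fun j => (z j : R)) (mem_univ i)]
  linear_combination (σ i : R) * (∏ j ∈ univ.erase i, (z j : R)) * hr i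

lemma prod_mul_sum_inv_eq_clearedSum [DecidableEq ι] (hz : ∀ i, z i ≠ 0) :
    (∏ i, (z i : ℚ)) * ∑ i, σ i * (z i : ℚ)⁻¹ = clearedSum σ z :=
  prod_mul_sum_eq_clearedSum fun i => mul_inv_cancel₀ (Nat.cast_ne_zero.mpr (hz i))

lemma sq_dvd_prod_of_sum_inv_eq_zero (hz : ∀ i, z i ≠ 0)
    (h : ∑ i, σ i * (z i : ℚ)⁻¹ = 0) {p : ℕ} (hp : p.Prime) (hσ : ∀ i, ¬ (p : ℤ) ∣ σ i)
    (hdvd : p ∣ ∏ i, z i) : p ^ 2 ∣ ∏ i, z i := by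
  classical
  obtain ⟨i, -, hi⟩ := hp.prime.exists_mem_finset_dvd hdvd
  have hzero : clearedSum σ z = 0 := by
    rw [← Int.cast_eq_zero (α := ℚ), ← prod_mul_sum_inv_eq_clearedSum hz, h, mul_zero]
  rw [clearedSum, ← add_sum_erase univ _ (mem_univ i)] at hzero
  have hrest : (p : ℤ) ∣ ∑ j ∈ univ.erase i, σ j * ∏ l ∈ univ.erase j, (z l : ℤ) := by
    refine dvd_sum fun j hj => Dvd.dvd.mul_left ?_ _
    exact (Int.natCast_dvd_natCast.mpr hi).trans
      (dvd_prod_of_mem _ (mem_erase.mpr ⟨(ne_of_mem_erase hj).symm, mem_univ i⟩))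
  have hterm : (p : ℤ) ∣ σ i * ∏ l ∈ univ.erase i, (z l : ℤ) :=
    (dvd_add_left hrest).mp (hzero ▸ dvd_zero _)
  have hothers : p ∣ ∏ l ∈ univ.erase i, z l := by
    exact_mod_cast ((Nat.prime_iff_prime_int.mp hp).dvd_or_dvd hterm).resolve_left (hσ i)
  rw [← mul_prod_erase univ z (mem_univ i), sq]
  exact mul_dvd_mul hi hothers

lemma le_abs_sum_inv_mul_prod {m : ℕ} (hz : ∀ i, (z i).Coprime m) (hz₀ : ∀ i, z i ≠ 0)
    (hmod : ∑ i, σ i * (z i : ZMod m)⁻¹ = 0) (hrat : ∑ i, σ i * (z i : ℚ)⁻¹ ≠ 0) :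
    (m : ℚ) ≤ |∑ i, σ i * (z i : ℚ)⁻¹| * ∏ i, (z i : ℚ) := by
  classical
  have hprod : 0 < ∏ i, (z i : ℚ) :=
    prod_pos fun i _ => Nat.cast_pos.mpr (Nat.pos_of_ne_zero (hz₀ i))
  have hnum := prod_mul_sum_inv_eq_clearedSum (σ := σ) hz₀
  have hdvd : (m : ℤ) ∣ clearedSum σ z := by
    rw [← ZMod.intCast_zmod_eq_zero_iff_dvd,
      ← prod_mul_sum_eq_clearedSum fun i => ZMod.coe_mul_inv_eq_one (z i) (hz i), hmod, mul_zero]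
  have hne : clearedSum σ z ≠ 0 := by
    rw [← Int.cast_ne_zero (α := ℚ), ← hnum]
    exact mul_ne_zero hprod.ne' hrat
  calc (m : ℚ) ≤ |(clearedSum σ z : ℚ)| := by
        exact_mod_cast Int.le_of_dvd (abs_pos.mpr hne) ((dvd_abs _ _).mpr hdvd)
    _ = |∑ i, σ i * (z i : ℚ)⁻¹| * ∏ i, (z i : ℚ) := by
        rw [← hnum, abs_mul, abs_of_pos hprod, mul_comm]

end ClearedSum

lemma exists_eq_mul_sq_of_forall_prime_sq_dvd {n : ℕ}
    (h : ∀ p : ℕ, p.Prime → p ∣ n → p ^ 2 ∣ n) : ∃ a b : ℕ, a ∣ b ∧ n = a * b ^ 2 := by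
  obtain ⟨a, b, hab, hsq⟩ := Nat.sq_mul_squarefree n
  refine ⟨a, b, ?_, by rw [← hab, mul_comm]⟩
  rw [← Nat.prod_primeFactors_of_squarefree hsq]
  refine prod_primes_dvd b (fun p hp => (Nat.prime_of_mem_primeFactors hp).prime) fun p hp => ?_
  have hprime := Nat.prime_of_mem_primeFactors hp
  have hpn : p ∣ n := hab ▸ (Nat.dvd_of_mem_primeFactors hp).mul_left _
  have hpp : p * p ∣ a * b ^ 2 := by
    rw [← sq, mul_comm a, hab]
    exact h p hprime hpn
  exact hprime.dvd_of_dvd_pow (Squarefree.dvd_of_squarefree_of_mul_dvd_mul_right hsq hpp)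

section Collisions

variable {α β γ : Type*} [DecidableEq β] [DecidableEq γ]

/-- The number of pairs of points of `S`, the diagonal included, on which `g` agrees. -/
def collisions (S : Finset α) (g : α → β) : ℕ :=
  #{p ∈ S ×ˢ S | g p.1 = g p.2}

lemma collisions_eq_sum_sq {S : Finset α} {g : α → β} {T : Finset β} (h : Set.MapsTo g S T) :
    collisions S g = ∑ t ∈ T, #{x ∈ S | g x = t} ^ 2 := by
  rw [collisions, card_eq_sum_card_fiberwise (f := fun p => g p.1) (t := T)]
  · refine sum_congr rfl fun t _ => ?_
    rw [sq, ← card_product]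
    congr 1
    ext p
    simp only [mem_filter, mem_product]
    constructor
    · rintro ⟨⟨⟨h₁, h₂⟩, heq⟩, ht⟩
      exact ⟨⟨h₁, ht⟩, h₂, heq ▸ ht⟩
    · rintro ⟨⟨h₁, ht⟩, h₂, ht'⟩
      exact ⟨⟨⟨h₁, h₂⟩, ht.trans ht'.symm⟩, ht⟩
  · exact fun p hp => h (mem_product.mp (mem_filter.mp hp).1).1

lemma collisions_eq_card_of_injOn {S : Finset α} {g : α → β} (h : Set.InjOn g S) :
    collisions S g = #S := by
  classical
  rw [collisions, ← diag_card S]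
  congr 1
  ext p
  simp only [mem_filter, mem_product, mem_diag]
  constructor
  · rintro ⟨⟨h₁, h₂⟩, heq⟩
    exact ⟨h₁, h h₁ h₂ heq⟩
  · rintro ⟨h₁, heq⟩
    exact ⟨⟨h₁, heq ▸ h₁⟩, congrArg g heq⟩

lemma sq_card_le_card_image_mul_collisions (S : Finset α) (q : α → γ) :
    #S ^ 2 ≤ #(S.image q) * collisions S q := by
  rw [collisions_eq_sum_sq (T := S.image q) fun _ => mem_image_of_mem q,
    card_eq_sum_card_image q S]
  exact_mod_cast sq_sum_le_card_mul_sum_sq (α := ℕ)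

lemma sum_collisions_fiber_le (S : Finset α) (g : α → β) (q : α → γ) :
    ∑ t ∈ S.image g, collisions {x ∈ S | g x = t} q ≤ collisions S q := by
  have hmaps : Set.MapsTo (fun p : α × α => g p.1)
      (({p ∈ S ×ˢ S | q p.1 = q p.2} : Finset (α × α)) : Set (α × α)) (S.image g) :=
    fun p hp => mem_image_of_mem g (mem_product.mp (mem_filter.mp hp).1).1
  rw [collisions, card_eq_sum_card_fiberwise hmaps]
  refine sum_le_sum fun t _ => card_le_card fun p hp => ?_
  simp only [mem_filter, mem_product] at hp ⊢
  exact ⟨⟨⟨hp.1.1.1, hp.1.2.1⟩, hp.2⟩, hp.1.1.2⟩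

lemma collisions_le_mul {S : Finset α} {g : α → β} {q : α → γ} {K : ℕ}
    (hK : ∀ t, #({x ∈ S | g x = t}.image q) ≤ K) :
    collisions S g ≤ K * collisions S q := by
  calc collisions S g = ∑ t ∈ S.image g, #{x ∈ S | g x = t} ^ 2 :=
        collisions_eq_sum_sq fun _ => mem_image_of_mem g
    _ ≤ ∑ t ∈ S.image g, K * collisions {x ∈ S | g x = t} q := by
        refine sum_le_sum fun t _ => (sq_card_le_card_image_mul_collisions _ q).trans ?_
        exact Nat.mul_le_mul_right _ (hK t)
    _ ≤ K * collisions S q := by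
        rw [← mul_sum]
        exact Nat.mul_le_mul_left K (sum_collisions_fiber_le S g q)

end Collisions

section Energy

variable {ι G : Type*} [AddCommMonoid G] [DecidableEq G]

/-- The additive energy of order `k` of the family `f` on `A`: the number of solutions of
`f x₁ + ⋯ + f x_k = f y₁ + ⋯ + f y_k` with all unknowns in `A`. -/
def energy (k : ℕ) (A : Finset ι) (f : ι → G) : ℕ :=
  collisions (Fintype.piFinset fun _ : Fin k => A) fun x => ∑ i, f (x i)

/-- The number of representations of `s` as a sum of `k` values of `f` on `A`. -/
def repCount (k : ℕ) (A : Finset ι) (f : ι → G) (s : G) : ℕ :=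
  #{x ∈ Fintype.piFinset fun _ : Fin k => A | ∑ i, f (x i) = s}

lemma energy_eq_sum_repCount_sq [Fintype G] (k : ℕ) (A : Finset ι) (f : ι → G) :
    energy k A f = ∑ s, repCount k A f s ^ 2 :=
  collisions_eq_sum_sq fun _ _ => mem_univ _

lemma sum_repCount [Fintype G] (k : ℕ) (A : Finset ι) (f : ι → G) :
    ∑ s, repCount k A f s = #A ^ k := by
  rw [← Fintype.card_piFinset_const A k]
  exact (card_eq_sum_card_fiberwise fun _ _ => mem_univ _).symm

lemma energy_mono (k : ℕ) {A B : Finset ι} (h : A ⊆ B) (f : ι → G) :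
    energy k A f ≤ energy k B f := by
  have hsub := Fintype.piFinset_subset (fun _ : Fin k => A) (fun _ => B) fun _ => h
  exact card_le_card (filter_subset_filter _ (product_subset_product hsub hsub))

lemma energy_one {A : Finset ι} {f : ι → G} (hf : Set.InjOn f A) : energy 1 A f = #A := by
  rw [energy, collisions_eq_card_of_injOn, Fintype.card_piFinset_const, pow_one]
  intro x hx y hy hxy
  simp only [Fin.sum_univ_one] at hxy
  funext i
  rw [Subsingleton.elim i 0]
  exact hf (Fintype.mem_piFinset.mp hx 0) (Fintype.mem_piFinset.mp hy 0) hxy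

lemma energy_map_of_injective {H : Type*} [AddCommMonoid H] [DecidableEq H] {φ : G →+ H}
    (hφ : Function.Injective φ) (k : ℕ) (A : Finset ι) (f : ι → G) :
    energy k A (fun x => φ (f x)) = energy k A f := by
  simp only [energy, collisions, ← map_sum, hφ.eq_iff]

end Energy

section RationalEnergy

variable {k N : ℕ} {x y : Fin k → ℕ}

lemma sq_dvd_prod_mul_prod_of_sum_inv_eq (hx : ∀ i, x i ≠ 0) (hy : ∀ i, y i ≠ 0)
    (h : ∑ i, (x i : ℚ)⁻¹ = ∑ i, (y i : ℚ)⁻¹) {p : ℕ} (hp : p.Prime)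
    (hdvd : p ∣ (∏ i, x i) * ∏ i, y i) : p ^ 2 ∣ (∏ i, x i) * ∏ i, y i := by
  have hne : ¬ (p : ℤ) ∣ 1 := (Nat.prime_iff_prime_int.mp hp).not_dvd_one
  have hsq := sq_dvd_prod_of_sum_inv_eq_zero (z := Sum.elim x y)
    (σ := Sum.elim (fun _ => 1) fun _ => -1) (Sum.rec hx hy) (by simp [h]) hp
    (Sum.rec (fun _ => hne) fun _ => by rwa [Sum.elim_inr, dvd_neg])
  simp only [Fintype.prod_sum_type, Sum.elim_inl, Sum.elim_inr] at hsq
  exact hsq hdvd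

lemma exists_forall_mem_divisors_of_sum_inv_eq (hx : ∀ i, x i ∈ Icc 1 N)
    (hy : ∀ i, y i ∈ Icc 1 N) (h : ∑ i, (x i : ℚ)⁻¹ = ∑ i, (y i : ℚ)⁻¹) :
    ∃ b ∈ Icc 1 (N ^ k), ∃ a ∈ b.divisors,
      (∀ i, x i ∈ (a * b ^ 2).divisors) ∧ ∀ i, y i ∈ (a * b ^ 2).divisors := by
  have hne : ∀ z : Fin k → ℕ, (∀ i, z i ∈ Icc 1 N) → ∀ i, z i ≠ 0 := fun z hz i =>
    Nat.one_le_iff_ne_zero.mp (mem_Icc.mp (hz i)).1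
  have hprod : (∏ i, x i) * ∏ i, y i ≠ 0 :=
    mul_ne_zero (prod_ne_zero_iff.mpr fun i _ => hne x hx i)
      (prod_ne_zero_iff.mpr fun i _ => hne y hy i)
  have hle : ∀ z : Fin k → ℕ, (∀ i, z i ∈ Icc 1 N) → ∏ i, z i ≤ N ^ k := fun z hz => by
    simpa only [card_univ, Fintype.card_fin] using
      prod_le_pow_card univ z N fun i _ => (mem_Icc.mp (hz i)).2
  obtain ⟨a, b, hab, heq⟩ := exists_eq_mul_sq_of_forall_prime_sq_dvd
    fun p => sq_dvd_prod_mul_prod_of_sum_inv_eq (hne x hx) (hne y hy) h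
  rw [heq] at hprod
  have ha : 0 < a := Nat.pos_of_ne_zero (left_ne_zero_of_mul hprod)
  have hb : b ≠ 0 := ne_zero_pow two_ne_zero (right_ne_zero_of_mul hprod)
  have hbN : b ≤ N ^ k := by
    refine le_of_pow_le_pow_left₀ two_ne_zero (Nat.zero_le _) ?_
    calc b ^ 2 ≤ a * b ^ 2 := Nat.le_mul_of_pos_left _ ha
      _ ≤ N ^ k * N ^ k := heq ▸ Nat.mul_le_mul (hle x hx) (hle y hy)
      _ = (N ^ k) ^ 2 := (sq _).symm
  refine ⟨b, mem_Icc.mpr ⟨Nat.pos_of_ne_zero hb, hbN⟩, a, Nat.mem_divisors.mpr ⟨hab, hb⟩,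
    fun i => Nat.mem_divisors.mpr ⟨?_, hprod⟩, fun i => Nat.mem_divisors.mpr ⟨?_, hprod⟩⟩
  · exact heq ▸ (dvd_prod_of_mem x (mem_univ i)).mul_right _
  · exact heq ▸ (dvd_prod_of_mem y (mem_univ i)).mul_left _

lemma energy_inv_le_of_card_divisors_le {D : ℕ}
    (hD : ∀ n, n ≠ 0 → n ≤ N ^ (3 * k) → #n.divisors ≤ D) :
    energy k (Icc 1 N) (fun x => (x : ℚ)⁻¹) ≤ N ^ k * D ^ (2 * k + 1) := by
  set P : ℕ → Finset (Fin k → ℕ) := fun n => Fintype.piFinset fun _ => n.divisors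
  have hpair : ∀ b ∈ Icc 1 (N ^ k), ∀ a ∈ b.divisors,
      #(P (a * b ^ 2) ×ˢ P (a * b ^ 2)) ≤ D ^ (2 * k) := fun b hb a ha => by
    rw [mem_Icc] at hb
    have hle : a * b ^ 2 ≤ N ^ (3 * k) := by
      calc a * b ^ 2 ≤ N ^ k * (N ^ k) ^ 2 :=
            Nat.mul_le_mul ((Nat.divisor_le ha).trans hb.2) (Nat.pow_le_pow_left hb.2 2)
        _ = N ^ (3 * k) := by ring
    have hne : a * b ^ 2 ≠ 0 :=
      mul_ne_zero (Nat.pos_of_mem_divisors ha).ne' (pow_ne_zero 2 (by lia))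
    rw [card_product, Fintype.card_piFinset_const, ← pow_add, ← two_mul]
    exact Nat.pow_le_pow_left (hD _ hne hle) _
  have hfiber : ∀ b ∈ Icc 1 (N ^ k), ∑ a ∈ b.divisors, #(P (a * b ^ 2) ×ˢ P (a * b ^ 2))
      ≤ D ^ (2 * k + 1) := fun b hb => by
    have hbN : b ≤ N ^ (3 * k) := by
      rw [pow_mul']
      exact (mem_Icc.mp hb).2.trans (Nat.le_self_pow three_ne_zero _)
    calc _ ≤ #b.divisors * D ^ (2 * k) := sum_le_card_nsmul _ _ _ (hpair b hb)
      _ ≤ D * D ^ (2 * k) :=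
          Nat.mul_le_mul_right _ (hD b (Nat.one_le_iff_ne_zero.mp (mem_Icc.mp hb).1) hbN)
      _ = D ^ (2 * k + 1) := (pow_succ' _ _).symm
  calc energy k (Icc 1 N) (fun x => (x : ℚ)⁻¹)
      ≤ #((Icc 1 (N ^ k)).biUnion fun b =>
          b.divisors.biUnion fun a => P (a * b ^ 2) ×ˢ P (a * b ^ 2)) := by
        refine card_le_card fun ⟨x, y⟩ hxy => ?_
        simp only [mem_filter, mem_product, Fintype.mem_piFinset] at hxy
        simpa only [P, mem_biUnion, mem_product, Fintype.mem_piFinset] using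
          exists_forall_mem_divisors_of_sum_inv_eq hxy.1.1 hxy.1.2 hxy.2
    _ ≤ ∑ b ∈ Icc 1 (N ^ k), ∑ a ∈ b.divisors, #(P (a * b ^ 2) ×ˢ P (a * b ^ 2)) :=
        card_biUnion_le.trans (sum_le_sum fun _ _ => card_biUnion_le)
    _ ≤ #(Icc 1 (N ^ k)) * D ^ (2 * k + 1) := sum_le_card_nsmul _ _ _ hfiber
    _ = N ^ k * D ^ (2 * k + 1) := by rw [Nat.card_Icc, Nat.add_sub_cancel]

end RationalEnergy

theorem exists_energy_inv_le (K : ℕ) {η : ℝ} (hη : 0 < η) :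
    ∃ C : ℝ, 1 ≤ C ∧ ∀ k ≤ K, ∀ N : ℕ, 1 ≤ N →
      (energy k (Icc 1 N) (fun x => (x : ℚ)⁻¹) : ℝ) ≤ C * N ^ k * (N : ℝ) ^ η := by
  set θ : ℝ := η / ((3 * K + 1) * (2 * K + 1))
  obtain ⟨C, hC, hdiv⟩ := exists_card_divisors_le (η := θ) (by positivity)
  refine ⟨C ^ (2 * K + 1), one_le_pow₀ hC, fun k hk N hN => ?_⟩
  have hN' : (1 : ℝ) ≤ N := by exact_mod_cast hN
  have henergy := energy_inv_le_of_card_divisors_le (k := k) (N := N)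
    (D := ⌊C * (N : ℝ) ^ (3 * k * θ)⌋₊) fun n hn hnN => Nat.le_floor <| (hdiv n hn).trans <| by
      have hnN' : (n : ℝ) ≤ (N : ℝ) ^ (3 * k) := by exact_mod_cast hnN
      rw [Real.rpow_mul N.cast_nonneg, ← Nat.cast_ofNat, ← Nat.cast_mul, Real.rpow_natCast]
      gcongr
  have hexp : (3 * k * θ) * (2 * k + 1) ≤ η := by
    have hk' : (k : ℝ) ≤ K := by exact_mod_cast hk
    calc (3 * k * θ) * (2 * k + 1) ≤ ((3 * K + 1) * θ) * (2 * K + 1) := by gcongr; linarith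
      _ = η := by simp only [θ]; field_simp
  calc (energy k (Icc 1 N) (fun x => (x : ℚ)⁻¹) : ℝ)
      ≤ N ^ k * (C * (N : ℝ) ^ (3 * k * θ)) ^ (2 * k + 1) := by
        refine (Nat.cast_le.mpr henergy).trans ?_
        push_cast
        gcongr
        exact Nat.floor_le (by positivity)
    _ = C ^ (2 * k + 1) * N ^ k * (N : ℝ) ^ ((3 * k * θ) * (2 * k + 1)) := by
        rw [mul_pow, ← Real.rpow_mul_natCast N.cast_nonneg]
        push_cast
        ring
    _ ≤ C ^ (2 * K + 1) * N ^ k * (N : ℝ) ^ η := by gcongr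

lemma exists_energy_inv_le_of_pow_le (K : ℕ) {η : ℝ} (hη : 0 < η) :
    ∃ C : ℝ, 1 ≤ C ∧ ∀ l ≤ K, ∀ N : ℕ, 1 ≤ N → ∀ X : ℝ, (N : ℝ) ^ l ≤ X →
      (energy (l + 1) (Icc 1 N) (fun x => (x : ℚ)⁻¹) : ℝ) ≤ C * N ^ (l + 1) * X ^ η := by
  obtain ⟨C, hC, henergy⟩ := exists_energy_inv_le (K + 1) hη
  refine ⟨C, hC, fun l hl N hN X hX => ?_⟩
  have hN' : (1 : ℝ) ≤ N := by exact_mod_cast hN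
  rcases Nat.eq_zero_or_pos l with rfl | hl₀
  · have hX' : 1 ≤ X ^ η := Real.one_le_rpow (by simpa only [pow_zero] using hX) hη.le
    rw [energy_one fun x _ y _ h => Nat.cast_injective (inv_injective h), Nat.card_Icc,
      Nat.add_sub_cancel, zero_add, pow_one, mul_right_comm]
    exact le_mul_of_one_le_left N.cast_nonneg (one_le_mul_of_one_le_of_one_le hC hX')
  · refine (henergy (l + 1) (by lia) N hN).trans ?_
    gcongr
    exact (le_self_pow₀ hN' hl₀.ne').trans hX

lemma card_le_floor_div_add_one_of_gaps {𝕜 : Type*} [Field 𝕜] [LinearOrder 𝕜]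
    [IsStrictOrderedRing 𝕜] [FloorSemiring 𝕜] {T : Finset 𝕜} {L g : 𝕜} (hg : 0 < g)
    (hT : ∀ t ∈ T, t ∈ Set.Icc 0 L) (hgap : (T : Set 𝕜).Pairwise fun s t => g ≤ |s - t|) :
    #T ≤ ⌊L / g⌋₊ + 1 := by
  rw [← card_range (⌊L / g⌋₊ + 1)]
  refine card_le_card_of_injOn (fun t => ⌊t / g⌋₊) (fun t ht => ?_) fun s hs t ht hst => ?_
  · rw [coe_range, Set.mem_Iio, Nat.lt_succ_iff]
    exact Nat.floor_le_floor (div_le_div_of_nonneg_right (hT t ht).2 hg.le)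
  · by_contra hne
    have hfloor : |s / g - t / g| < 1 := by
      have hs₀ := Nat.floor_le (div_nonneg (hT s hs).1 hg.le)
      have ht₀ := Nat.floor_le (div_nonneg (hT t ht).1 hg.le)
      have hs₁ := Nat.lt_floor_add_one (s / g)
      have ht₁ := Nat.lt_floor_add_one (t / g)
      rw [show ⌊s / g⌋₊ = ⌊t / g⌋₊ from hst] at hs₀ hs₁
      rw [abs_lt]
      constructor <;> linarith
    rw [← sub_div, abs_div, abs_of_pos hg, div_lt_one hg] at hfloor
    exact (hgap hs ht hne).not_gt hfloor

/-- The integers of `[M, N]` coprime to `m`. -/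
def coprimesIcc (m M N : ℕ) : Finset ℕ :=
  {x ∈ Icc M N | x.Coprime m}

section CoprimesIcc

variable {m M N k : ℕ}

lemma mem_coprimesIcc {x : ℕ} : x ∈ coprimesIcc m M N ↔ (M ≤ x ∧ x ≤ N) ∧ x.Coprime m := by
  rw [coprimesIcc, mem_filter, mem_Icc]

lemma coprimesIcc_subset_Icc (hM : M ≠ 0) : coprimesIcc m M N ⊆ Icc 1 N := fun x hx => by
  rw [mem_coprimesIcc] at hx
  exact mem_Icc.mpr ⟨by lia, hx.1.2⟩

lemma card_coprimesIcc_le (hM : M ≠ 0) : #(coprimesIcc m M N) ≤ N := by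
  simpa only [Nat.card_Icc, Nat.add_sub_cancel] using card_le_card (coprimesIcc_subset_Icc hM)

lemma coprimesIcc_subset_coprimesIcc_one (hM : M ≠ 0) :
    coprimesIcc m M N ⊆ coprimesIcc m 1 N :=
  filter_subset_filter _ (Icc_subset_Icc_left (Nat.one_le_iff_ne_zero.mpr hM))

lemma card_coprimesIcc_one_sdiff_le :
    #(coprimesIcc m 1 N \ coprimesIcc m M N) ≤ M - 1 := by
  calc #(coprimesIcc m 1 N \ coprimesIcc m M N) ≤ #(Icc 1 (M - 1)) := by
        refine card_le_card fun x hx => ?_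
        simp only [mem_sdiff, mem_coprimesIcc] at hx
        rw [mem_Icc]
        lia
    _ = M - 1 := by rw [Nat.card_Icc, Nat.add_sub_cancel]

lemma div_pow_le_abs_sub_of_sum_inv_zmod_eq {x y : Fin k → ℕ} (hM : M ≠ 0) (hN : N ≠ 0)
    (hx : ∀ i, x i ∈ coprimesIcc m M N) (hy : ∀ i, y i ∈ coprimesIcc m M N)
    (hmod : ∑ i, (x i : ZMod m)⁻¹ = ∑ i, (y i : ZMod m)⁻¹)
    (hne : ∑ i, (x i : ℚ)⁻¹ ≠ ∑ i, (y i : ℚ)⁻¹) :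
    (m : ℚ) / (N : ℚ) ^ (2 * k) ≤ |∑ i, (x i : ℚ)⁻¹ - ∑ i, (y i : ℚ)⁻¹| := by
  simp only [mem_coprimesIcc] at hx hy
  have hspacing := le_abs_sum_inv_mul_prod (z := Sum.elim x y)
    (σ := Sum.elim (fun _ => 1) fun _ => -1) (m := m)
    (Sum.rec (fun i => (hx i).2) fun i => (hy i).2)
    (Sum.rec (fun i => by have := (hx i).1.1; rw [Sum.elim_inl]; lia)
      fun i => by have := (hy i).1.1; rw [Sum.elim_inr]; lia)
    (by simp [hmod]) (by simpa [← sub_eq_add_neg, sub_eq_zero] using hne)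
  simp only [Fintype.sum_sum_type, Fintype.prod_sum_type, Sum.elim_inl, Sum.elim_inr, Int.cast_one,
    Int.cast_neg, one_mul, neg_mul, sum_neg_distrib, ← sub_eq_add_neg] at hspacing
  have hprod : ∀ z : Fin k → ℕ, (∀ i, z i ≤ N) → ∏ i, (z i : ℚ) ≤ (N : ℚ) ^ k := fun z hz => by
    have := prod_le_pow_card univ z N fun i _ => hz i
    rw [card_univ, Fintype.card_fin] at this
    exact_mod_cast this
  rw [div_le_iff₀ (by positivity), two_mul, pow_add]
  refine hspacing.trans ?_
  gcongr
  exacts [hprod x fun i => (hx i).1.2, hprod y fun i => (hy i).1.2]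

theorem energy_zmod_inv_le (hm : m ≠ 0) (hM : M ≠ 0) (hN : N ≠ 0) :
    energy k (coprimesIcc m M N) (fun x => (x : ZMod m)⁻¹) ≤
      (k * N ^ (2 * k) / (M * m) + 1) *
        energy k (coprimesIcc m M N) (fun x => (x : ℚ)⁻¹) := by
  refine collisions_le_mul fun s => ?_
  have hfloor : ⌊(k / M : ℚ) / (m / N ^ (2 * k))⌋₊ = k * N ^ (2 * k) / (M * m) := by
    rw [← Nat.floor_div_eq_div (K := ℚ), div_div_div_eq]
    push_cast
    rfl
  rw [← hfloor]
  refine card_le_floor_div_add_one_of_gaps (by positivity) (fun t ht => ?_)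
    fun t ht u hu htu => ?_
  · obtain ⟨x, hx, rfl⟩ := mem_image.mp ht
    rw [mem_filter, Fintype.mem_piFinset] at hx
    refine ⟨sum_nonneg fun i _ => by positivity, ?_⟩
    calc ∑ i, (x i : ℚ)⁻¹ ≤ ∑ _i : Fin k, (M : ℚ)⁻¹ := by
          gcongr with i
          exact (mem_coprimesIcc.mp (hx.1 i)).1.1
      _ = k / M := by
          rw [sum_const, card_univ, Fintype.card_fin, nsmul_eq_mul, div_eq_mul_inv]
  · obtain ⟨x, hx, rfl⟩ := mem_image.mp ht
    obtain ⟨y, hy, rfl⟩ := mem_image.mp hu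
    rw [mem_filter, Fintype.mem_piFinset] at hx hy
    exact div_pow_le_abs_sub_of_sum_inv_zmod_eq hM hN hx.1 hy.1 (hx.2.trans hy.2.symm) htu

end CoprimesIcc

lemma sum_mul_pow_succ_le {ι : Type*} {s : Finset ι} {w f : ι → ℝ} (hw : ∀ i, 0 ≤ w i)
    (hf : ∀ i, 0 ≤ f i) (k : ℕ) :
    (∑ i ∈ s, w i * f i) ^ (k + 1) ≤ (∑ i ∈ s, w i) ^ k * ∑ i ∈ s, w i * f i ^ (k + 1) := by
  have hholder := Real.inner_le_weight_mul_Lp_of_nonneg s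
    (p := (k + 1 : ℕ)) (by exact_mod_cast Nat.le_add_left 1 k) w f hw hf
  simp only [Real.rpow_natCast] at hholder
  have hW : 0 ≤ ∑ i ∈ s, w i := sum_nonneg fun i _ => hw i
  have hWf : 0 ≤ ∑ i ∈ s, w i * f i ^ (k + 1) :=
    sum_nonneg fun i _ => mul_nonneg (hw i) (pow_nonneg (hf i) _)
  have hexp : (1 - ((k + 1 : ℕ) : ℝ)⁻¹) * (k + 1 : ℕ) = k := by
    field_simp
    push_cast
    ring
  calc (∑ i ∈ s, w i * f i) ^ (k + 1)
      ≤ ((∑ i ∈ s, w i) ^ (1 - ((k + 1 : ℕ) : ℝ)⁻¹) *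
          (∑ i ∈ s, w i * f i ^ (k + 1)) ^ ((k + 1 : ℕ) : ℝ)⁻¹) ^ (k + 1) :=
        pow_le_pow_left₀ (sum_nonneg fun i _ => mul_nonneg (hw i) (hf i)) hholder _
    _ = (∑ i ∈ s, w i) ^ k * ∑ i ∈ s, w i * f i ^ (k + 1) := by
        rw [mul_pow, Real.rpow_inv_natCast_pow hWf k.succ_ne_zero, ← Real.rpow_mul_natCast hW,
          hexp, Real.rpow_natCast]

lemma addChar_sum_eq_prod {G M ι : Type*} [AddCommMonoid G] [CommMonoid M] (ψ : AddChar G M)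
    (s : Finset ι) (f : ι → G) : ψ (∑ i ∈ s, f i) = ∏ i ∈ s, ψ (f i) :=
  map_prod ψ.toMonoidHom (fun i => Multiplicative.ofAdd (f i)) s

section ExpSum

variable {R : Type*} [CommRing R] {ψ : AddChar R ℂ} {ι κ : Type*}

lemma sum_addChar_mul_addChar_neg [Fintype R] [DecidableEq R] (hψ : ψ.IsPrimitive) (r s : R) :
    ∑ c, ψ (c * r) * ψ (-(c * s)) = if r = s then (Fintype.card R : ℂ) else 0 := by
  simp_rw [← AddChar.map_add_eq_mul, ← sub_eq_add_neg, ← mul_sub]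
  simp only [AddChar.sum_mulShift _ hψ, sub_eq_zero, Nat.cast_ite, Nat.cast_zero]

lemma sum_norm_sq_sum_mul_addChar [Fintype R] (hψ : ψ.IsPrimitive) (b : R → ℂ) :
    ∑ c, ‖∑ r, b r * ψ (c * r)‖ ^ 2 = Fintype.card R * ∑ r, ‖b r‖ ^ 2 := by
  classical
  have hcomplex : ∑ c, (‖∑ r, b r * ψ (c * r)‖ : ℂ) ^ 2
      = Fintype.card R * ∑ r, (‖b r‖ : ℂ) ^ 2 := by
    calc ∑ c, (‖∑ r, b r * ψ (c * r)‖ : ℂ) ^ 2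
        = ∑ c, ∑ r, ∑ s, b r * (starRingEnd ℂ) (b s) * (ψ (c * r) * ψ (-(c * s))) := by
          refine sum_congr rfl fun c _ => ?_
          rw [← Complex.mul_conj', map_sum, sum_mul_sum]
          refine sum_congr rfl fun r _ => sum_congr rfl fun s _ => ?_
          rw [map_mul (starRingEnd ℂ), AddChar.map_neg_eq_conj]
          ring
      _ = ∑ r, ∑ s, b r * (starRingEnd ℂ) (b s) * ∑ c, ψ (c * r) * ψ (-(c * s)) := by
          rw [sum_comm]
          refine sum_congr rfl fun r _ => ?_
          rw [sum_comm]
          simp_rw [mul_sum]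
      _ = ∑ r, b r * (starRingEnd ℂ) (b r) * Fintype.card R := by
          simp_rw [sum_addChar_mul_addChar_neg hψ, mul_ite, mul_zero, sum_ite_eq, mem_univ, if_true]
      _ = Fintype.card R * ∑ r, (‖b r‖ : ℂ) ^ 2 := by
          rw [mul_sum]
          refine sum_congr rfl fun r _ => ?_
          rw [Complex.mul_conj', mul_comm]
  exact_mod_cast hcomplex

/-- The weighted exponential sum of the family `f` over `A`, at the frequency `c`. -/
def expSum (ψ : AddChar R ℂ) (A : Finset ι) (f : ι → R) (α : ι → ℂ) (c : R) : ℂ :=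
  ∑ x ∈ A, α x * ψ (c * f x)

variable [Fintype R] [DecidableEq R] {A : Finset ι} {B : Finset κ} {f : ι → R} {g : κ → R}
  {α : ι → ℂ} {β : κ → ℂ}

lemma exists_expSum_pow_eq (hα : ∀ x ∈ A, ‖α x‖ ≤ 1) (k : ℕ) :
    ∃ b : R → ℂ, (∀ r, ‖b r‖ ≤ repCount k A f r) ∧
      ∀ c, expSum ψ A f α c ^ k = ∑ r, b r * ψ (c * r) := by
  set P : Finset (Fin k → ι) := Fintype.piFinset fun _ => A
  refine ⟨fun r => ∑ x ∈ P with ∑ i, f (x i) = r, ∏ i, α (x i), fun r => ?_, fun c => ?_⟩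
  · rw [repCount, ← nsmul_one]
    refine norm_sum_le_of_le _ (fun x hx => ?_) |>.trans_eq (sum_const 1)
    rw [norm_prod]
    exact prod_le_one (fun _ _ => norm_nonneg _)
      fun i _ => hα _ (Fintype.mem_piFinset.mp (mem_filter.mp hx).1 i)
  · rw [expSum, sum_pow', ← sum_fiberwise P fun x => ∑ i, f (x i)]
    refine sum_congr rfl fun r _ => ?_
    rw [sum_mul]
    refine sum_congr rfl fun x hx => ?_
    rw [prod_mul_distrib, ← (mem_filter.mp hx).2, mul_sum, addChar_sum_eq_prod]

lemma sum_norm_expSum_pow_sq_le (hψ : ψ.IsPrimitive) (hα : ∀ x ∈ A, ‖α x‖ ≤ 1) (k : ℕ) :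
    ∑ c, (‖expSum ψ A f α c‖ ^ k) ^ 2 ≤ Fintype.card R * energy k A f := by
  obtain ⟨b, hb, hpow⟩ := exists_expSum_pow_eq (ψ := ψ) (f := f) hα k
  simp_rw [← norm_pow _ k, hpow]
  rw [sum_norm_sq_sum_mul_addChar hψ, energy_eq_sum_repCount_sq]
  push_cast
  gcongr with r
  exact hb r

lemma exists_sum_norm_expSum_pow_le (A : Finset ι) (f : ι → R) (hβ : ∀ y ∈ B, ‖β y‖ ≤ 1) (k : ℕ) :
    ∃ θ : ι → ℂ, (∀ x, ‖θ x‖ ≤ 1) ∧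
      ∑ x ∈ A, ‖expSum ψ B g β (f x)‖ ^ k ≤ ∑ r, repCount k B g r * ‖expSum ψ A f θ r‖ := by
  obtain ⟨b, hb, hpow⟩ := exists_expSum_pow_eq (ψ := ψ) (f := g) hβ k
  choose θ hθ hθmul using fun x => Complex.exists_norm_eq_mul_self (expSum ψ B g β (f x) ^ k)
  refine ⟨θ, fun x => (hθ x).le, ?_⟩
  have hdual : ((∑ x ∈ A, ‖expSum ψ B g β (f x)‖ ^ k : ℝ) : ℂ)
      = ∑ r, b r * expSum ψ A f θ r := by
    push_cast
    simp_rw [← Complex.ofReal_pow, ← norm_pow, hθmul, hpow, expSum, mul_sum]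
    rw [sum_comm]
    refine sum_congr rfl fun r _ => sum_congr rfl fun x _ => ?_
    rw [mul_comm r]
    ring
  rw [← Complex.norm_of_nonneg (sum_nonneg fun x _ => pow_nonneg (norm_nonneg _) k), hdual]
  refine norm_sum_le_of_le _ fun r _ => ?_
  rw [norm_mul]
  gcongr
  exact hb r

lemma sum_norm_expSum_pow_pow_le (hψ : ψ.IsPrimitive) (A : Finset ι) (f : ι → R)
    (hβ : ∀ y ∈ B, ‖β y‖ ≤ 1) (k₁ k₂ : ℕ) :
    (∑ x ∈ A, ‖expSum ψ B g β (f x)‖ ^ k₂) ^ (2 * (k₁ + 1)) ≤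
      (#B : ℝ) ^ (2 * k₂ * k₁) *
        (Fintype.card R * energy (k₁ + 1) A f * energy k₂ B g) := by
  obtain ⟨θ, hθ, hdual⟩ := exists_sum_norm_expSum_pow_le (ψ := ψ) (g := g) A f hβ k₂
  have hrep : ∑ r, (repCount k₂ B g r : ℝ) = (#B : ℝ) ^ k₂ := by
    exact_mod_cast sum_repCount k₂ B g
  calc (∑ x ∈ A, ‖expSum ψ B g β (f x)‖ ^ k₂) ^ (2 * (k₁ + 1))
      ≤ ((∑ r, repCount k₂ B g r * ‖expSum ψ A f θ r‖) ^ (k₁ + 1)) ^ 2 := by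
        rw [mul_comm, pow_mul]
        gcongr
    _ ≤ (((#B : ℝ) ^ k₂) ^ k₁ *
          ∑ r, repCount k₂ B g r * ‖expSum ψ A f θ r‖ ^ (k₁ + 1)) ^ 2 := by
        rw [← hrep]
        gcongr
        exact sum_mul_pow_succ_le (fun _ => Nat.cast_nonneg _) (fun _ => norm_nonneg _) k₁
    _ = (#B : ℝ) ^ (2 * k₂ * k₁) *
          (∑ r, repCount k₂ B g r * ‖expSum ψ A f θ r‖ ^ (k₁ + 1)) ^ 2 := by ring
    _ ≤ (#B : ℝ) ^ (2 * k₂ * k₁) *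
          ((∑ r, (repCount k₂ B g r : ℝ) ^ 2) * ∑ r, (‖expSum ψ A f θ r‖ ^ (k₁ + 1)) ^ 2) := by
        gcongr
        exact sum_mul_sq_le_sq_mul_sq _ _ _
    _ ≤ (#B : ℝ) ^ (2 * k₂ * k₁) *
          (energy k₂ B g * (Fintype.card R * energy (k₁ + 1) A f)) := by
        gcongr
        · rw [energy_eq_sum_repCount_sq]
          push_cast
          rfl
        · exact sum_norm_expSum_pow_sq_le hψ (fun x _ => hθ x) _
    _ = (#B : ℝ) ^ (2 * k₂ * k₁) *
          (Fintype.card R * energy (k₁ + 1) A f * energy k₂ B g) := by ring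

theorem norm_sum_sum_mul_addChar_pow_le (hψ : ψ.IsPrimitive) (hα : ∀ x ∈ A, ‖α x‖ ≤ 1)
    (hβ : ∀ y ∈ B, ‖β y‖ ≤ 1) (f : ι → R) (g : κ → R) (k₁ k₂ : ℕ) :
    ‖∑ x ∈ A, ∑ y ∈ B, α x * β y * ψ (f x * g y)‖ ^ (2 * (k₁ + 1) * (k₂ + 1)) ≤
      (#A : ℝ) ^ (2 * (k₁ + 1) * k₂) * (#B : ℝ) ^ (2 * (k₂ + 1) * k₁) *
        (Fintype.card R * energy (k₁ + 1) A f * energy (k₂ + 1) B g) := by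
  have hnorm : ‖∑ x ∈ A, ∑ y ∈ B, α x * β y * ψ (f x * g y)‖
      ≤ ∑ x ∈ A, ‖expSum ψ B g β (f x)‖ := by
    refine norm_sum_le_of_le _ fun x hx => ?_
    simp_rw [mul_assoc (α x), ← mul_sum, norm_mul]
    exact mul_le_of_le_one_left (norm_nonneg _) (hα x hx)
  have hmean := sum_mul_pow_succ_le (s := A) (w := fun _ => 1) (fun _ => zero_le_one)
    (fun x => norm_nonneg (expSum ψ B g β (f x))) k₂
  simp only [one_mul, sum_const, nsmul_eq_mul, mul_one] at hmean
  calc ‖∑ x ∈ A, ∑ y ∈ B, α x * β y * ψ (f x * g y)‖ ^ (2 * (k₁ + 1) * (k₂ + 1))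
      ≤ ((∑ x ∈ A, ‖expSum ψ B g β (f x)‖) ^ (k₂ + 1)) ^ (2 * (k₁ + 1)) := by
        rw [← pow_mul, mul_comm (k₂ + 1)]
        gcongr
    _ ≤ ((#A : ℝ) ^ k₂ * ∑ x ∈ A, ‖expSum ψ B g β (f x)‖ ^ (k₂ + 1)) ^ (2 * (k₁ + 1)) := by
        gcongr
    _ = (#A : ℝ) ^ (2 * (k₁ + 1) * k₂) *
          (∑ x ∈ A, ‖expSum ψ B g β (f x)‖ ^ (k₂ + 1)) ^ (2 * (k₁ + 1)) := by ring
    _ ≤ (#A : ℝ) ^ (2 * (k₁ + 1) * k₂) * ((#B : ℝ) ^ (2 * (k₂ + 1) * k₁) *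
          (Fintype.card R * energy (k₁ + 1) A f * energy (k₂ + 1) B g)) := by
        gcongr
        exact sum_norm_expSum_pow_pow_le hψ A f hβ k₁ (k₂ + 1)
    _ = _ := (mul_assoc _ _ _).symm

end ExpSum

lemma exists_pow_le_sqrt_lt_pow {m N : ℕ} {ε : ℝ} (hε : 0 < ε) (hm : 2 ≤ m)
    (hN : (m : ℝ) ^ ε ≤ N) :
    ∃ l ≤ ⌊1 / (2 * ε)⌋₊, (N : ℝ) ^ l ≤ √m ∧ √m < (N : ℝ) ^ (l + 1) := by
  have hm₁ : (1 : ℝ) < m := by exact_mod_cast hm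
  obtain ⟨l, hlow, hhigh⟩ := exists_nat_pow_near (Real.one_le_sqrt.mpr hm₁.le)
    ((Real.one_lt_rpow hm₁ hε).trans_le hN)
  refine ⟨l, Nat.le_floor ?_, hlow, hhigh⟩
  have hexp : (m : ℝ) ^ (ε * l) ≤ (m : ℝ) ^ (1 / 2 : ℝ) := by
    calc (m : ℝ) ^ (ε * l) = ((m : ℝ) ^ ε) ^ l := Real.rpow_mul_natCast (by positivity) _ _
      _ ≤ (N : ℝ) ^ l := by gcongr
      _ ≤ (m : ℝ) ^ (1 / 2 : ℝ) := by rwa [← Real.sqrt_eq_rpow]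
  rw [le_div_iff₀ (by positivity)]
  linarith [(Real.rpow_le_rpow_left_iff hm₁).mp hexp]

lemma pow_lt_or_lt_pow_of_notMem_criticalWindows {m N j : ℕ} {ε : ℝ} (hε : 0 ≤ ε) (hm : 1 ≤ m)
    (hj : j ≠ 0) (hN : (N : ℝ) ∉ criticalWindows m ε) :
    (N : ℝ) ^ j < √m * (m : ℝ) ^ (-ε) ∨ √m * (m : ℝ) ^ ε < (N : ℝ) ^ j := by
  have hm₁ : (1 : ℝ) ≤ m := by exact_mod_cast hm
  have hj₁ : (1 : ℝ) ≤ j := by exact_mod_cast Nat.one_le_iff_ne_zero.mpr hj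
  have hpow (s : ℝ) : ((m : ℝ) ^ (1 / (2 * (j : ℝ)) + s)) ^ j = √m * (m : ℝ) ^ (s * j) := by
    rw [← Real.rpow_mul_natCast (by positivity), Real.sqrt_eq_rpow,
      ← Real.rpow_add (by positivity)]
    congr 1
    field_simp
  have hwindow : ¬ ((m : ℝ) ^ (1 / (2 * (j : ℝ)) - ε) ≤ N ∧
      N ≤ (m : ℝ) ^ (1 / (2 * (j : ℝ)) + ε)) := fun h =>
    hN <| Set.mem_iUnion₂.mpr ⟨j, Nat.one_le_iff_ne_zero.mpr hj, h⟩
  rw [not_and_or, not_le, not_le] at hwindow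
  refine hwindow.imp (fun h => ?_) fun h => ?_
  · calc (N : ℝ) ^ j < ((m : ℝ) ^ (1 / (2 * (j : ℝ)) + -ε)) ^ j :=
          pow_lt_pow_left₀ h (Nat.cast_nonneg N) hj
      _ ≤ √m * (m : ℝ) ^ (-ε) := by
          rw [hpow]
          gcongr
          exact mul_le_of_one_le_right (neg_nonpos.mpr hε) hj₁
  · calc √m * (m : ℝ) ^ ε ≤ ((m : ℝ) ^ (1 / (2 * (j : ℝ)) + ε)) ^ j := by
          rw [hpow]
          gcongr
          exact le_mul_of_one_le_right hε hj₁
      _ < (N : ℝ) ^ j := pow_lt_pow_left₀ h (by positivity) hj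

lemma pow_le_and_le_pow_of_notMem_criticalWindows {m N l : ℕ} {ε ε₀ : ℝ} (hε₀ : 0 ≤ ε₀)
    (hε₀ε : ε₀ ≤ ε) (hε₀_half : ε₀ ≤ 1 / 2) (hm : 1 ≤ m) (hlow : (N : ℝ) ^ l ≤ √m)
    (hhigh : √m ≤ (N : ℝ) ^ (l + 1)) (hN : (N : ℝ) ∉ criticalWindows m ε) :
    (N : ℝ) ^ l ≤ √m * (m : ℝ) ^ (-ε₀) ∧ √m ≤ (N : ℝ) ^ (l + 1) * (m : ℝ) ^ (-ε₀) := by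
  have hm₁ : (1 : ℝ) ≤ m := by exact_mod_cast hm
  have hε : 0 ≤ ε := hε₀.trans hε₀ε
  constructor
  · rcases eq_or_ne l 0 with rfl | hl
    · rw [pow_zero, Real.sqrt_eq_rpow, ← Real.rpow_add (by positivity)]
      exact Real.one_le_rpow hm₁ (by linarith)
    · rcases pow_lt_or_lt_pow_of_notMem_criticalWindows hε hm hl hN with h | h
      · refine h.le.trans ?_
        gcongr
      · have hgrow : √m ≤ √m * (m : ℝ) ^ ε :=
          le_mul_of_one_le_right (Real.sqrt_nonneg _) (Real.one_le_rpow hm₁ hε)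
        exact absurd (hlow.trans hgrow) h.not_ge
  · rcases pow_lt_or_lt_pow_of_notMem_criticalWindows hε hm l.succ_ne_zero hN with h | h
    · have hshrink : √m * (m : ℝ) ^ (-ε) ≤ √m :=
        mul_le_of_le_one_right (Real.sqrt_nonneg _)
          (Real.rpow_le_one_of_one_le_of_nonpos hm₁ (neg_nonpos.mpr hε))
      exact absurd (hshrink.trans hhigh) h.not_ge
    · rw [Real.rpow_neg (by positivity), ← div_eq_mul_inv, le_div_iff₀ (by positivity)]
      refine le_trans ?_ h.le
      gcongr

lemma sqrt_mul_energy_zmod_inv_le {m M N l : ℕ} {C P g : ℝ} (hm : m ≠ 0) (hN : N ≠ 0)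
    (hC : 0 ≤ C) (hP : 1 ≤ P) (hM : (N : ℝ) ≤ M * P)
    (henergy : (energy (l + 1) (Icc 1 N) (fun x => (x : ℚ)⁻¹) : ℝ) ≤ C * N ^ (l + 1) * P)
    (hlow : (N : ℝ) ^ l ≤ √m * g) (hhigh : √m ≤ (N : ℝ) ^ (l + 1) * g) :
    √m * energy (l + 1) (coprimesIcc m M N) (fun x => (x : ZMod m)⁻¹) ≤
      C * (l + 2) * P ^ 2 * N ^ (2 * (l + 1)) * g := by
  have hM₀ : M ≠ 0 := by
    rintro rfl
    rw [Nat.cast_zero, zero_mul, Nat.cast_nonpos] at hM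
    exact hN hM
  have hsqrt : 0 < √(m : ℝ) := Real.sqrt_pos.mpr (by positivity)
  have hmod : (energy (l + 1) (coprimesIcc m M N) (fun x => (x : ZMod m)⁻¹) : ℝ) ≤
      ((l + 1) * N ^ (2 * (l + 1)) / (M * m) + 1) * (C * N ^ (l + 1) * P) := by
    have hnat := (energy_zmod_inv_le (k := l + 1) hm hM₀ hN).trans
      (Nat.mul_le_mul_left _ (energy_mono (l + 1) (coprimesIcc_subset_Icc hM₀) _))
    refine (Nat.cast_le.mpr hnat).trans ?_
    rw [Nat.cast_mul, Nat.cast_add_one]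
    gcongr
    refine Nat.cast_div_le.trans_eq ?_
    push_cast
    rfl
  calc √m * energy (l + 1) (coprimesIcc m M N) (fun x => (x : ZMod m)⁻¹)
      ≤ √m * (((l + 1) * N ^ (2 * (l + 1)) / (M * m) + 1) * (C * N ^ (l + 1) * P)) := by gcongr
    _ = C * P * N ^ (2 * (l + 1)) * (l + 1) * (N / M) * (N ^ l / √m) +
          C * P * N ^ (l + 1) * √m := by
        nth_rewrite 2 [← Real.mul_self_sqrt (Nat.cast_nonneg m)]
        field_simp
        ring
    _ ≤ C * P * N ^ (2 * (l + 1)) * (l + 1) * P * g +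
          C * P * N ^ (l + 1) * (N ^ (l + 1) * g) := by
        gcongr
        · exact (div_le_iff₀' (by positivity)).mpr hM
        · exact (div_le_iff₀' hsqrt).mpr hlow
    _ = C * P * N ^ (2 * (l + 1)) * g * ((l + 1) * P + 1) := by ring
    _ ≤ C * P * N ^ (2 * (l + 1)) * g * ((l + 1) * P + P) := by
        have hg : 0 ≤ g := nonneg_of_mul_nonneg_right (hsqrt.le.trans hhigh) (by positivity)
        gcongr
    _ = C * (l + 2) * P ^ 2 * N ^ (2 * (l + 1)) * g := by ring

theorem exists_sqrt_mul_energy_zmod_inv_le {ε ε₀ η : ℝ} (hε₀ : 0 < ε₀) (hε₀ε : ε₀ ≤ ε)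
    (hε₀_half : ε₀ ≤ 1 / 2) (hη : 0 < η) :
    ∃ C : ℝ, 1 ≤ C ∧ ∃ K : ℕ, ∀ m : ℕ, 2 ≤ m → ∀ M N : ℕ, (m : ℝ) ^ ε ≤ N →
      (N : ℝ) ≤ M * (m : ℝ) ^ η → ∃ l ≤ K,
        √m * energy (l + 1) (coprimesIcc m M N) (fun x => (x : ZMod m)⁻¹) ≤
          C * ((m : ℝ) ^ η) ^ 2 * N ^ (2 * (l + 1)) ∧
        ((N : ℝ) ∉ criticalWindows m ε →
          √m * energy (l + 1) (coprimesIcc m M N) (fun x => (x : ZMod m)⁻¹) ≤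
            C * ((m : ℝ) ^ η) ^ 2 * N ^ (2 * (l + 1)) * (m : ℝ) ^ (-ε₀)) := by
  obtain ⟨C, hC, henergy⟩ := exists_energy_inv_le_of_pow_le ⌊1 / (2 * ε)⌋₊ hη
  refine ⟨C * (⌊1 / (2 * ε)⌋₊ + 2), by nlinarith [Nat.cast_nonneg (α := ℝ) ⌊1 / (2 * ε)⌋₊],
    ⌊1 / (2 * ε)⌋₊, fun m hm M N hN hM => ?_⟩
  have hm₀ : m ≠ 0 := by lia
  have hm₁ : (1 : ℝ) ≤ m := by exact_mod_cast one_le_two.trans hm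
  have hN₀ : N ≠ 0 := by
    have hpos : (0 : ℝ) < N := (Real.rpow_pos_of_pos (by positivity) ε).trans_le hN
    exact_mod_cast hpos.ne'
  obtain ⟨l, hlK, hlow, hhigh⟩ := exists_pow_le_sqrt_lt_pow (hε₀.trans_le hε₀ε) hm hN
  have hlm : (N : ℝ) ^ l ≤ m := hlow.trans (Real.sqrt_le_self_iff.mpr (Or.inr hm₁))
  have hgain (g : ℝ) (hlow : (N : ℝ) ^ l ≤ √m * g) (hhigh : √m ≤ (N : ℝ) ^ (l + 1) * g) :
      √m * energy (l + 1) (coprimesIcc m M N) (fun x => (x : ZMod m)⁻¹) ≤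
        C * (⌊1 / (2 * ε)⌋₊ + 2) * ((m : ℝ) ^ η) ^ 2 * N ^ (2 * (l + 1)) * g := by
    have hg : 0 ≤ g :=
      nonneg_of_mul_nonneg_right ((Real.sqrt_nonneg _).trans hhigh) (by positivity)
    refine (sqrt_mul_energy_zmod_inv_le hm₀ hN₀ (by positivity)
      (Real.one_le_rpow hm₁ hη.le) hM
      (henergy l hlK N (Nat.one_le_iff_ne_zero.mpr hN₀) m hlm) hlow hhigh).trans ?_
    gcongr
  refine ⟨l, hlK, ?_, fun hwindow => ?_⟩
  · simpa only [mul_one] using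
      hgain 1 (hlow.trans_eq (mul_one _).symm) (hhigh.le.trans_eq (mul_one _).symm)
  · obtain ⟨hlow', hhigh'⟩ := pow_le_and_le_pow_of_notMem_criticalWindows hε₀.le hε₀ε hε₀_half
      (one_le_two.trans hm) hlow hhigh.le hwindow
    exact hgain _ hlow' hhigh'

/-- The estimate `‖S‖ ≤ t * N₁ * N₂` for all bilinear Kloosterman sums `S` modulo `m` whose lengths
are at least `m ^ ε`, one of them lying outside the critical windows. -/
def BilinearKloostermanBound (ε : ℝ) (m : ℕ) (t : ℝ) : Prop :=
  ∀ N₁ N₂ : ℕ, (m : ℝ) ^ ε ≤ N₁ → (m : ℝ) ^ ε ≤ N₂ →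
    ((N₁ : ℝ) ∉ criticalWindows m ε ∨ (N₂ : ℝ) ∉ criticalWindows m ε) →
    ∀ α₁ α₂ : ℕ → ℂ, (∀ x ∈ Icc 1 N₁, ‖α₁ x‖ ≤ 1) → (∀ x ∈ Icc 1 N₂, ‖α₂ x‖ ≤ 1) →
    ∀ a : ℤ, IsCoprime a m → ‖bilinearKloosterman m a α₁ α₂ N₁ N₂‖ ≤ t * (N₁ * N₂)

lemma eMod_mul_recip_mul_recip {m : ℕ} [NeZero m] (a : ℤ) (x y : ℕ) :
    eMod m (a * recip m x * recip m y) =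
      ZMod.stdAddChar ((a : ZMod m) * (x : ZMod m)⁻¹ * (y : ZMod m)⁻¹) := by
  have hcast : ((a * recip m x * recip m y : ℤ) : ZMod m) =
      a * (x : ZMod m)⁻¹ * (y : ZMod m)⁻¹ := by
    simp [recip]
  rw [← hcast, ZMod.stdAddChar_coe, eMod]

lemma norm_sum_sum_le_add {ι κ E : Type*} [DecidableEq ι] [DecidableEq κ]
    [SeminormedAddCommGroup E] {f : ι → κ → E} {X A : Finset ι} {Y B : Finset κ} (hA : A ⊆ X)
    (hB : B ⊆ Y) (hf : ∀ x ∈ X, ∀ y ∈ Y, ‖f x y‖ ≤ 1) :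
    ‖∑ x ∈ X, ∑ y ∈ Y, f x y‖ ≤
      ‖∑ x ∈ A, ∑ y ∈ B, f x y‖ + #(X \ A) * #Y + #X * #(Y \ B) := by
  have hle : ∀ U ⊆ X, ∀ V ⊆ Y, ‖∑ x ∈ U, ∑ y ∈ V, f x y‖ ≤ #U * #V := fun U hU V hV => by
    calc ‖∑ x ∈ U, ∑ y ∈ V, f x y‖ ≤ ∑ _ ∈ U, ∑ _ ∈ V, (1 : ℝ) :=
          norm_sum_le_of_le _ fun x hx => norm_sum_le_of_le _ fun y hy => hf x (hU hx) y (hV hy)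
      _ = #U * #V := by simp only [sum_const, nsmul_eq_mul, mul_one]
  have hsplit : ∑ x ∈ X, ∑ y ∈ Y, f x y = ∑ x ∈ A, ∑ y ∈ B, f x y +
      ∑ x ∈ X \ A, ∑ y ∈ Y, f x y + ∑ x ∈ A, ∑ y ∈ Y \ B, f x y := by
    rw [← sum_sdiff hA]
    simp_rw [← sum_sdiff hB, sum_add_distrib]
    abel
  rw [hsplit]
  refine norm_add₃_le.trans ?_
  gcongr
  · exact hle _ sdiff_subset _ subset_rfl
  · refine (hle A hA _ sdiff_subset).trans ?_
    gcongr

lemma norm_sum_sum_coprimesIcc_pow_le {m M₁ M₂ N₁ N₂ l₁ l₂ : ℕ} [NeZero m] {α₁ α₂ : ℕ → ℂ}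
    {a : ℤ} {D₁ D₂ : ℝ} (hM₁ : M₁ ≠ 0) (hM₂ : M₂ ≠ 0) (hα₁ : ∀ x ∈ Icc 1 N₁, ‖α₁ x‖ ≤ 1)
    (hα₂ : ∀ x ∈ Icc 1 N₂, ‖α₂ x‖ ≤ 1) (ha : IsCoprime a m)
    (hD₁ : √m * energy (l₁ + 1) (coprimesIcc m M₁ N₁) (fun x => (x : ZMod m)⁻¹) ≤
      D₁ * N₁ ^ (2 * (l₁ + 1)))
    (hD₂ : √m * energy (l₂ + 1) (coprimesIcc m M₂ N₂) (fun x => (x : ZMod m)⁻¹) ≤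
      D₂ * N₂ ^ (2 * (l₂ + 1))) :
    ‖∑ x ∈ coprimesIcc m M₁ N₁, ∑ y ∈ coprimesIcc m M₂ N₂,
        α₁ x * α₂ y * eMod m (a * recip m x * recip m y)‖ ^ (2 * (l₁ + 1) * (l₂ + 1)) ≤
      (N₁ * N₂ : ℝ) ^ (2 * (l₁ + 1) * (l₂ + 1)) * (D₁ * D₂) := by
  have hunit : IsUnit (a : ZMod m) := (ZMod.coe_int_isUnit_iff_isCoprime a m).mpr ha.symm
  have hbound := norm_sum_sum_mul_addChar_pow_le (ZMod.isPrimitive_stdAddChar m)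
    (A := coprimesIcc m M₁ N₁) (B := coprimesIcc m M₂ N₂)
    (fun x hx => hα₁ x (coprimesIcc_subset_Icc hM₁ hx))
    (fun x hx => hα₂ x (coprimesIcc_subset_Icc hM₂ hx))
    (fun x => (a : ZMod m) * (x : ZMod m)⁻¹) (fun y => (y : ZMod m)⁻¹) l₁ l₂
  have hdilate := energy_map_of_injective (φ := AddMonoidHom.mulLeft (a : ZMod m))
    hunit.mul_right_injective (l₁ + 1) (coprimesIcc m M₁ N₁) fun x => (x : ZMod m)⁻¹
  simp only [AddMonoidHom.coe_mulLeft] at hdilate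
  rw [hdilate, ZMod.card] at hbound
  simp_rw [eMod_mul_recip_mul_recip]
  refine hbound.trans ?_
  set E₁ := energy (l₁ + 1) (coprimesIcc m M₁ N₁) fun x => (x : ZMod m)⁻¹
  set E₂ := energy (l₂ + 1) (coprimesIcc m M₂ N₂) fun x => (x : ZMod m)⁻¹
  calc (#(coprimesIcc m M₁ N₁) : ℝ) ^ (2 * (l₁ + 1) * l₂) *
        (#(coprimesIcc m M₂ N₂) : ℝ) ^ (2 * (l₂ + 1) * l₁) * (m * E₁ * E₂)
      ≤ (N₁ : ℝ) ^ (2 * (l₁ + 1) * l₂) * (N₂ : ℝ) ^ (2 * (l₂ + 1) * l₁) * (m * E₁ * E₂) := by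
        gcongr
        · exact card_coprimesIcc_le hM₁
        · exact card_coprimesIcc_le hM₂
    _ = (N₁ : ℝ) ^ (2 * (l₁ + 1) * l₂) * (N₂ : ℝ) ^ (2 * (l₂ + 1) * l₁) *
          ((√m * E₁) * (√m * E₂)) := by
        nth_rewrite 1 [← Real.mul_self_sqrt (Nat.cast_nonneg m)]
        ring
    _ ≤ (N₁ : ℝ) ^ (2 * (l₁ + 1) * l₂) * (N₂ : ℝ) ^ (2 * (l₂ + 1) * l₁) *
          ((D₁ * N₁ ^ (2 * (l₁ + 1))) * (D₂ * N₂ ^ (2 * (l₂ + 1)))) := by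
        refine mul_le_mul_of_nonneg_left ?_ (by positivity)
        exact mul_le_mul hD₁ hD₂ (by positivity) (le_trans (by positivity) hD₁)
    _ = (N₁ * N₂ : ℝ) ^ (2 * (l₁ + 1) * (l₂ + 1)) * (D₁ * D₂) := by ring

lemma le_mul_mul_rpow_of_pow_le {s P C x κ : ℝ} {n n₀ : ℕ} (hP : 0 ≤ P) (hC : 1 ≤ C)
    (hx : 1 ≤ x) (hκ : 0 ≤ κ) (hn : n ≠ 0) (hnn₀ : n ≤ n₀)
    (h : s ^ n ≤ P ^ n * (C * x ^ (-κ))) : s ≤ P * (C * x ^ (-(κ / n₀))) := by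
  refine le_of_pow_le_pow_left₀ hn (by positivity) (h.trans ?_)
  rw [mul_pow, mul_pow C, ← Real.rpow_mul_natCast (by positivity)]
  have hexp : κ / n₀ * n ≤ κ := by
    rw [div_mul_eq_mul_div]
    exact div_le_of_le_mul₀ (Nat.cast_nonneg _) hκ (by gcongr)
  gcongr
  · exact le_self_pow₀ hC hn
  · rwa [neg_mul, neg_le_neg_iff]

theorem exists_norm_sum_sum_coprimesIcc_le {ε ε₀ : ℝ} (hε₀ : 0 < ε₀) (hε₀ε : ε₀ ≤ ε)
    (hε₀_half : ε₀ ≤ 1 / 2) :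
    ∃ C : ℝ, 1 ≤ C ∧ ∃ c : ℝ, 0 < c ∧ ∀ m : ℕ, 2 ≤ m → ∀ M₁ M₂ N₁ N₂ : ℕ, M₁ ≠ 0 → M₂ ≠ 0 →
      (m : ℝ) ^ ε ≤ N₁ → (m : ℝ) ^ ε ≤ N₂ →
      (N₁ : ℝ) ≤ M₁ * (m : ℝ) ^ (ε₀ / 8) → (N₂ : ℝ) ≤ M₂ * (m : ℝ) ^ (ε₀ / 8) →
      ((N₁ : ℝ) ∉ criticalWindows m ε ∨ (N₂ : ℝ) ∉ criticalWindows m ε) →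
      ∀ α₁ α₂ : ℕ → ℂ, (∀ x ∈ Icc 1 N₁, ‖α₁ x‖ ≤ 1) → (∀ x ∈ Icc 1 N₂, ‖α₂ x‖ ≤ 1) →
      ∀ a : ℤ, IsCoprime a m →
        ‖∑ x ∈ coprimesIcc m M₁ N₁, ∑ y ∈ coprimesIcc m M₂ N₂,
          α₁ x * α₂ y * eMod m (a * recip m x * recip m y)‖ ≤
            N₁ * N₂ * (C * (m : ℝ) ^ (-c)) := by
  obtain ⟨C, hC, K, henergy⟩ :=
    exists_sqrt_mul_energy_zmod_inv_le hε₀ hε₀ε hε₀_half (η := ε₀ / 8) (by positivity)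
  refine ⟨C ^ 2, one_le_pow₀ hC, ε₀ / 2 / (2 * (K + 1) * (K + 1) : ℕ), by positivity, ?_⟩
  intro m hm M₁ M₂ N₁ N₂ hM₁ hM₂ hN₁ hN₂ hMN₁ hMN₂ hwindow α₁ α₂ hα₁ hα₂ a ha
  have : NeZero m := ⟨by lia⟩
  have hm₁ : (1 : ℝ) ≤ m := by exact_mod_cast one_le_two.trans hm
  obtain ⟨l₁, hl₁, hE₁, hE₁'⟩ := henergy m hm M₁ N₁ hN₁ hMN₁
  obtain ⟨l₂, hl₂, hE₂, hE₂'⟩ := henergy m hm M₂ N₂ hN₂ hMN₂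
  set D := C * ((m : ℝ) ^ (ε₀ / 8)) ^ 2
  set g := (m : ℝ) ^ (-ε₀)
  have hDD : D * D * g = C ^ 2 * (m : ℝ) ^ (-(ε₀ / 2)) := by
    calc D * D * g = C ^ 2 * ((m : ℝ) ^ (ε₀ / 8 * (4 : ℕ)) * (m : ℝ) ^ (-ε₀)) := by
          rw [Real.rpow_mul_natCast (by positivity)]
          ring
      _ = C ^ 2 * (m : ℝ) ^ (-(ε₀ / 2)) := by
          rw [← Real.rpow_add (by positivity)]
          congr 2
          push_cast
          ring
  refine le_mul_mul_rpow_of_pow_le (by positivity) (one_le_pow₀ hC) hm₁ (by positivity)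
    (n := 2 * (l₁ + 1) * (l₂ + 1)) (by positivity) (by gcongr) ?_
  rw [← hDD]
  rcases hwindow with h | h
  · refine (norm_sum_sum_coprimesIcc_pow_le hM₁ hM₂ hα₁ hα₂ ha (D₁ := D * g) (D₂ := D)
      ((hE₁' h).trans_eq (by ring)) hE₂).trans_eq (by ring)
  · refine (norm_sum_sum_coprimesIcc_pow_le hM₁ hM₂ hα₁ hα₂ ha (D₁ := D) (D₂ := D * g)
      hE₁ ((hE₂' h).trans_eq (by ring))).trans_eq (by ring)

lemma exists_card_coprimesIcc_one_sdiff_le {m N : ℕ} {P : ℝ} (hP : 0 < P) (hN : 0 < N) :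
    ∃ M : ℕ, M ≠ 0 ∧ N ≤ M * P ∧
      (#(coprimesIcc m 1 N \ coprimesIcc m M N) : ℝ) ≤ N / P := by
  have hNP : 0 < N / P := by positivity
  have hceil := Nat.ceil_pos.mpr hNP
  refine ⟨⌈N / P⌉₊, hceil.ne', (div_le_iff₀ hP).mp (Nat.le_ceil _), ?_⟩
  calc (#(coprimesIcc m 1 N \ coprimesIcc m ⌈N / P⌉₊ N) : ℝ)
      ≤ (⌈N / P⌉₊ - 1 : ℕ) := by exact_mod_cast card_coprimesIcc_one_sdiff_le
    _ ≤ N / P := by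
        rw [Nat.cast_pred hceil]
        linarith [Nat.ceil_lt_add_one hNP.le]

theorem exists_bilinearKloostermanBound_rpow {ε : ℝ} (hε : 0 < ε) :
    ∃ C c : ℝ, 0 < c ∧ ∀ m : ℕ, 2 ≤ m → BilinearKloostermanBound ε m (C * (m : ℝ) ^ (-c)) := by
  set ε₀ := min ε (1 / 2)
  have hε₀ : 0 < ε₀ := lt_min hε one_half_pos
  obtain ⟨C, hC, c, hc, htruncated⟩ :=
    exists_norm_sum_sum_coprimesIcc_le hε₀ (min_le_left _ _) (min_le_right _ _)
  refine ⟨C + 2, min c (ε₀ / 8), lt_min hc (by positivity), ?_⟩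
  intro m hm N₁ N₂ hN₁ hN₂ hwindow α₁ α₂ hα₁ hα₂ a ha
  have : NeZero m := ⟨by lia⟩
  have hm₁ : (1 : ℝ) ≤ m := by exact_mod_cast one_le_two.trans hm
  have hpos (N : ℕ) (hN : (m : ℝ) ^ ε ≤ N) : 0 < N := by
    exact_mod_cast (Real.rpow_pos_of_pos (by positivity) ε).trans_le hN
  have hP : 0 < (m : ℝ) ^ (ε₀ / 8) := by positivity
  obtain ⟨M₁, hM₁, hMN₁, hcard₁⟩ :=
    exists_card_coprimesIcc_one_sdiff_le (m := m) hP (hpos N₁ hN₁)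
  obtain ⟨M₂, hM₂, hMN₂, hcard₂⟩ :=
    exists_card_coprimesIcc_one_sdiff_le (m := m) hP (hpos N₂ hN₂)
  have hterm (x) (hx : x ∈ coprimesIcc m 1 N₁) (y) (hy : y ∈ coprimesIcc m 1 N₂) :
      ‖α₁ x * α₂ y * eMod m (a * recip m x * recip m y)‖ ≤ 1 := by
    rw [eMod_mul_recip_mul_recip, norm_mul, norm_mul, AddChar.norm_apply, mul_one]
    exact mul_le_one₀ (hα₁ x (coprimesIcc_subset_Icc one_ne_zero hx)) (norm_nonneg _)
      (hα₂ y (coprimesIcc_subset_Icc one_ne_zero hy))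
  refine (norm_sum_sum_le_add (coprimesIcc_subset_coprimesIcc_one hM₁)
    (coprimesIcc_subset_coprimesIcc_one hM₂) hterm).trans ?_
  calc _ ≤ N₁ * N₂ * (C * (m : ℝ) ^ (-c)) + N₁ / (m : ℝ) ^ (ε₀ / 8) * N₂ +
          N₁ * (N₂ / (m : ℝ) ^ (ε₀ / 8)) := by
        gcongr
        · exact htruncated m hm M₁ M₂ N₁ N₂ hM₁ hM₂ hN₁ hN₂ hMN₁ hMN₂ hwindow α₁ α₂ hα₁ hα₂ a ha
        · exact card_coprimesIcc_le one_ne_zero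
        · exact card_coprimesIcc_le one_ne_zero
    _ = (C * (m : ℝ) ^ (-c) + 2 * (m : ℝ) ^ (-(ε₀ / 8))) * (N₁ * N₂) := by
        rw [Real.rpow_neg (Nat.cast_nonneg m) (ε₀ / 8)]
        ring
    _ ≤ (C * (m : ℝ) ^ (-min c (ε₀ / 8)) + 2 * (m : ℝ) ^ (-min c (ε₀ / 8))) * (N₁ * N₂) := by
        gcongr
        · exact min_le_left _ _
        · exact min_le_right _ _
    _ = (C + 2) * (m : ℝ) ^ (-min c (ε₀ / 8)) * (N₁ * N₂) := by ring

lemma norm_sum_Icc_le_of_norm_add_le {E : Type*} [SeminormedAddCommGroup E] {f : ℕ → E}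
    {B s : ℝ} {N : ℕ} (hf : ∀ n ∈ Icc 1 N, ‖f n‖ ≤ B)
    (hpair : ∀ n ∈ Icc 1 N, n + 1 ∈ Icc 1 N → ‖f n + f (n + 1)‖ ≤ 2 * B - s) :
    ‖∑ n ∈ Icc 1 N, f n‖ ≤ N * B - (N / 2 : ℕ) * s := by
  induction N using Nat.twoStepInduction with
  | zero => simp
  | one => simpa using hf 1 (by simp)
  | more N ih _ =>
    have hmono : Icc 1 N ⊆ Icc 1 (N + 2) := Icc_subset_Icc_right (by lia)
    have hsum := ih (fun n hn => hf n (hmono hn)) fun n hn hn' => hpair n (hmono hn) (hmono hn')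
    have hlast := hpair (N + 1) (by simp) (by simp)
    rw [sum_Icc_succ_top (by lia), sum_Icc_succ_top (by lia), add_assoc,
      Nat.add_div_right N two_pos]
    push_cast
    linarith [norm_add_le (∑ n ∈ Icc 1 N, f n) (f (N + 1) + f (N + 1 + 1))]

lemma norm_sum_sum_Icc_le_of_norm_add_add_add_le {E : Type*} [SeminormedAddCommGroup E]
    {f : ℕ → ℕ → E} {D : ℝ} {N₁ N₂ : ℕ} (hf : ∀ x ∈ Icc 1 N₁, ∀ y ∈ Icc 1 N₂, ‖f x y‖ ≤ 1)
    (hblock : ∀ x ∈ Icc 1 N₁, x + 1 ∈ Icc 1 N₁ → ∀ y ∈ Icc 1 N₂, y + 1 ∈ Icc 1 N₂ →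
      ‖f x y + f (x + 1) y + (f x (y + 1) + f (x + 1) (y + 1))‖ ≤ D) :
    ‖∑ x ∈ Icc 1 N₁, ∑ y ∈ Icc 1 N₂, f x y‖ ≤
      N₁ * N₂ - (N₁ / 2 : ℕ) * ((N₂ / 2 : ℕ) * (4 - D)) := by
  refine norm_sum_Icc_le_of_norm_add_le (fun x hx => ?_) fun x hx hx' => ?_
  · simpa using norm_sum_le_of_le _ (hf x hx)
  · rw [← sum_add_distrib, mul_comm 2]
    refine norm_sum_Icc_le_of_norm_add_le (fun y hy => ?_) fun y hy hy' => ?_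
    · linarith [norm_add_le_of_le (hf x hx y hy) (hf (x + 1) hx' y hy)]
    · linarith [hblock x hx hx' y hy hy']

lemma sq_norm_add_add_norm_add_le {F : Type*} [NormedAddCommGroup F] [InnerProductSpace ℝ F]
    {x y z : F} (hx : ‖x‖ ≤ 1) (hy : ‖y‖ ≤ 1) (hz : ‖z‖ ≤ 1) :
    (‖x + y‖ + ‖x + z‖) ^ 2 ≤ 8 + 4 * ‖y + z‖ := by
  have hinner : inner ℝ x y + inner ℝ x z ≤ ‖y + z‖ := by
    rw [← inner_add_right]
    exact (real_inner_le_norm _ _).trans (mul_le_of_le_one_left (norm_nonneg _) hx)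
  have hx' := pow_le_one₀ (n := 2) (norm_nonneg _) hx
  have hy' := pow_le_one₀ (n := 2) (norm_nonneg _) hy
  have hz' := pow_le_one₀ (n := 2) (norm_nonneg _) hz
  refine add_sq_le.trans ?_
  rw [norm_add_sq_real, norm_add_sq_real]
  linarith

section AddCharBlock

variable {G : Type*} [AddCommGroup G] [Finite G] {ψ : AddChar G ℂ}

lemma norm_addChar_block_le {α₁ α₂ β₁ β₂ : ℂ} (hα₁ : ‖α₁‖ ≤ 1) (hα₂ : ‖α₂‖ ≤ 1)
    (hβ₁ : ‖β₁‖ ≤ 1) (hβ₂ : ‖β₂‖ ≤ 1) (p q r s : G) :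
    ‖α₁ * β₁ * ψ p + α₂ * β₁ * ψ q + (α₁ * β₂ * ψ r + α₂ * β₂ * ψ s)‖ ≤
      √(8 + 4 * ‖ψ (q - p) + ψ (s - r)‖) := by
  have hfactor (β : ℂ) (u v : G) :
      α₁ * β * ψ u + α₂ * β * ψ v = β * ψ u * (α₁ + α₂ * ψ (v - u)) := by
    rw [← add_sub_cancel u v, AddChar.map_add_eq_mul, add_sub_cancel]
    ring
  have hweight (u : G) : ‖α₂ * ψ u‖ ≤ 1 := by
    rwa [norm_mul, AddChar.norm_apply, mul_one]
  have hrow {β : ℂ} (hβ : ‖β‖ ≤ 1) (u v : G) :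
      ‖α₁ * β * ψ u + α₂ * β * ψ v‖ ≤ ‖α₁ + α₂ * ψ (v - u)‖ := by
    rw [hfactor, norm_mul, norm_mul, AddChar.norm_apply, mul_one]
    exact mul_le_of_le_one_left (norm_nonneg _) hβ
  refine (norm_add_le_of_le (hrow hβ₁ p q) (hrow hβ₂ r s)).trans (Real.le_sqrt_of_sq_le ?_)
  refine (sq_norm_add_add_norm_add_le hα₁ (hweight _) (hweight _)).trans ?_
  rw [← mul_add, norm_mul]
  gcongr
  exact mul_le_of_le_one_left (norm_nonneg _) hα₂

lemma norm_addChar_add_lt_two (hψ : Function.Injective ψ) {u v : G} (huv : u ≠ v) :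
    ‖ψ u + ψ v‖ < 2 := by
  have hnorm : ‖ψ u‖ = ‖ψ v‖ := by rw [AddChar.norm_apply, AddChar.norm_apply]
  have hray : ¬ SameRay ℝ (ψ u) (ψ v) := (not_sameRay_iff_of_norm_eq hnorm).mpr (hψ.ne huv)
  calc ‖ψ u + ψ v‖ < ‖ψ u‖ + ‖ψ v‖ := norm_add_lt_of_not_sameRay hray
    _ = 2 := by rw [AddChar.norm_apply, AddChar.norm_apply, one_add_one_eq_two]

lemma norm_addChar_block_le_mul (α₁ α₂ β₁ β₂ : ℂ) (p q r s : G) :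
    ‖α₁ * β₁ * ψ p + α₂ * β₁ * ψ q + (α₁ * β₂ * ψ r + α₂ * β₂ * ψ s)‖ ≤
      (‖α₁‖ + ‖α₂‖) * (‖β₁‖ + ‖β₂‖) := by
  have hterm (α β : ℂ) (u : G) : ‖α * β * ψ u‖ ≤ ‖α‖ * ‖β‖ := by
    rw [norm_mul, norm_mul, AddChar.norm_apply, mul_one]
  refine (norm_add_le_of_le (norm_add_le_of_le (hterm _ _ _) (hterm _ _ _))
    (norm_add_le_of_le (hterm _ _ _) (hterm _ _ _))).trans_eq ?_
  ring

theorem exists_norm_addChar_block_le (hψ : Function.Injective ψ) :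
    ∃ D : ℝ, D < 4 ∧ ∀ α₁ α₂ β₁ β₂ : ℂ, ‖α₁‖ ≤ 1 → ‖α₂‖ ≤ 1 → ‖β₁‖ ≤ 1 → ‖β₂‖ ≤ 1 →
      ∀ p q r s : G, (α₁ ≠ 0 → α₂ ≠ 0 → β₁ ≠ 0 → β₂ ≠ 0 → q - p ≠ s - r) →
      ‖α₁ * β₁ * ψ p + α₂ * β₁ * ψ q + (α₁ * β₂ * ψ r + α₂ * β₂ * ψ s)‖ ≤ D := by
  have hlt (p q r s : G) (h : q - p ≠ s - r) : √(8 + 4 * ‖ψ (q - p) + ψ (s - r)‖) < 4 := by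
    rw [Real.sqrt_lt' four_pos]
    linarith [norm_addChar_add_lt_two hψ h]
  have heventually : ∀ᶠ D : ℝ in 𝓝[<] 4, ∀ p q r s : G, q - p ≠ s - r →
      √(8 + 4 * ‖ψ (q - p) + ψ (s - r)‖) ≤ D := by
    simp only [Filter.eventually_all]
    intro p q r s h
    filter_upwards [Ico_mem_nhdsLT (hlt p q r s h)] with D hD using hD.1
  obtain ⟨D, hD, hD₂, hD₄⟩ :=
    (heventually.and (Ico_mem_nhdsLT (by norm_num : (2 : ℝ) < 4))).exists
  refine ⟨D, hD₄, fun α₁ α₂ β₁ β₂ hα₁ hα₂ hβ₁ hβ₂ p q r s h => ?_⟩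
  by_cases hne : α₁ ≠ 0 ∧ α₂ ≠ 0 ∧ β₁ ≠ 0 ∧ β₂ ≠ 0
  · obtain ⟨hα₁', hα₂', hβ₁', hβ₂'⟩ := hne
    exact (norm_addChar_block_le hα₁ hα₂ hβ₁ hβ₂ p q r s).trans
      (hD p q r s (h hα₁' hα₂' hβ₁' hβ₂'))
  · have hprod : (‖α₁‖ + ‖α₂‖) * (‖β₁‖ + ‖β₂‖) ≤ 2 := by
      have hα : ‖α₁‖ + ‖α₂‖ ≤ 2 := by linarith
      have hβ : ‖β₁‖ + ‖β₂‖ ≤ 2 := by linarith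
      have hzero : α₁ = 0 ∨ α₂ = 0 ∨ β₁ = 0 ∨ β₂ = 0 := by tauto
      have hone : ‖α₁‖ + ‖α₂‖ ≤ 1 ∨ ‖β₁‖ + ‖β₂‖ ≤ 1 := by
        rcases hzero with rfl | rfl | rfl | rfl <;> simp [*]
      rcases hone with h₁ | h₁
      · simpa using mul_le_mul h₁ hβ (by positivity) zero_le_one
      · simpa using mul_le_mul hα h₁ (by positivity) zero_le_two
    exact (norm_addChar_block_le_mul α₁ α₂ β₁ β₂ p q r s).trans (hprod.trans hD₂)

end AddCharBlock

lemma isUnit_inv_succ_sub_inv {m x : ℕ} (hx : x.Coprime m) (hx' : (x + 1).Coprime m) :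
    IsUnit (((x + 1 : ℕ) : ZMod m)⁻¹ - (x : ZMod m)⁻¹) := by
  have hu := (ZMod.isUnit_iff_coprime x m).mpr hx
  have hv := (ZMod.isUnit_iff_coprime (x + 1) m).mpr hx'
  have hxu := ZMod.mul_inv_of_unit _ hu
  have hxv := ZMod.mul_inv_of_unit _ hv
  have hinv : ((x + 1 : ℕ) : ZMod m)⁻¹ - (x : ZMod m)⁻¹ =
      -(((x + 1 : ℕ) : ZMod m)⁻¹ * (x : ZMod m)⁻¹) := by
    push_cast at hxv ⊢
    linear_combination (x : ZMod m)⁻¹ * hxv - (x + 1 : ZMod m)⁻¹ * hxu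
  rw [hinv]
  exact ((IsUnit.of_mul_eq_one_right _ hxv).mul (IsUnit.of_mul_eq_one_right _ hxu)).neg

theorem exists_norm_consecutive_block_le {m : ℕ} (hm : 2 ≤ m) :
    ∃ D : ℝ, D < 4 ∧ ∀ a : ℤ, IsCoprime a m → ∀ α β : ℕ → ℂ,
      (∀ x, α x ≠ 0 → x.Coprime m) → (∀ y, β y ≠ 0 → y.Coprime m) →
      ∀ x y : ℕ, ‖α x‖ ≤ 1 → ‖α (x + 1)‖ ≤ 1 → ‖β y‖ ≤ 1 → ‖β (y + 1)‖ ≤ 1 →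
      let f := fun x y : ℕ => α x * β y * eMod m (a * recip m x * recip m y)
      ‖f x y + f (x + 1) y + (f x (y + 1) + f (x + 1) (y + 1))‖ ≤ D := by
  have : NeZero m := ⟨by lia⟩
  have : Fact (1 < m) := ⟨hm⟩
  obtain ⟨D, hD₄, hD⟩ := exists_norm_addChar_block_le (ZMod.injective_stdAddChar (N := m))
  refine ⟨D, hD₄, fun a ha α β hα hβ x y hαx hαx' hβy hβy' => ?_⟩
  simp only [eMod_mul_recip_mul_recip]
  refine hD _ _ _ _ hαx hαx' hβy hβy' _ _ _ _ fun h₁ h₂ h₃ h₄ heq => ?_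
  have hmixed : IsUnit ((a : ZMod m) * (((x + 1 : ℕ) : ZMod m)⁻¹ - (x : ZMod m)⁻¹) *
      (((y + 1 : ℕ) : ZMod m)⁻¹ - (y : ZMod m)⁻¹)) :=
    (((ZMod.coe_int_isUnit_iff_isCoprime a m).mpr ha.symm).mul
      (isUnit_inv_succ_sub_inv (hα _ h₁) (hα _ h₂))).mul
      (isUnit_inv_succ_sub_inv (hβ _ h₃) (hβ _ h₄))
  refine hmixed.ne_zero ?_
  linear_combination -heq

lemma bilinearKloosterman_eq_sum_sum_Icc (m : ℕ) (a : ℤ) (α₁ α₂ : ℕ → ℂ) (N₁ N₂ : ℕ) :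
    bilinearKloosterman m a α₁ α₂ N₁ N₂ = ∑ x ∈ Icc 1 N₁, ∑ y ∈ Icc 1 N₂,
      (if x.Coprime m then α₁ x else 0) * (if y.Coprime m then α₂ y else 0) *
        eMod m (a * recip m x * recip m y) := by
  simp only [bilinearKloosterman, sum_filter]
  refine sum_congr rfl fun x _ => ?_
  split_ifs
  · simp only [mul_ite, ite_mul, mul_zero, zero_mul]
  · simp only [zero_mul, sum_const_zero]

theorem exists_norm_bilinearKloosterman_le_sub {m : ℕ} (hm : 2 ≤ m) :
    ∃ D : ℝ, D < 4 ∧ ∀ N₁ N₂ : ℕ, ∀ α₁ α₂ : ℕ → ℂ,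
      (∀ x ∈ Icc 1 N₁, ‖α₁ x‖ ≤ 1) → (∀ x ∈ Icc 1 N₂, ‖α₂ x‖ ≤ 1) →
      ∀ a : ℤ, IsCoprime a m → ‖bilinearKloosterman m a α₁ α₂ N₁ N₂‖ ≤
        N₁ * N₂ - (N₁ / 2 : ℕ) * ((N₂ / 2 : ℕ) * (4 - D)) := by
  have : NeZero m := ⟨by lia⟩
  obtain ⟨D, hD₄, hD⟩ := exists_norm_consecutive_block_le hm
  refine ⟨D, hD₄, fun N₁ N₂ α₁ α₂ hα₁ hα₂ a ha => ?_⟩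
  have hweight {α : ℕ → ℂ} {x : ℕ} (hx : ‖α x‖ ≤ 1) : ‖if x.Coprime m then α x else 0‖ ≤ 1 := by
    split_ifs
    exacts [hx, by simp]
  rw [bilinearKloosterman_eq_sum_sum_Icc]
  refine norm_sum_sum_Icc_le_of_norm_add_add_add_le (fun x hx y hy => ?_)
    fun x hx hx' y hy hy' => ?_
  · rw [eMod_mul_recip_mul_recip, norm_mul, norm_mul, AddChar.norm_apply, mul_one]
    exact mul_le_one₀ (hweight (hα₁ x hx)) (norm_nonneg _) (hweight (hα₂ y hy))
  · exact hD a ha (fun x => if x.Coprime m then α₁ x else 0)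
      (fun y => if y.Coprime m then α₂ y else 0) (fun _ h => (ite_ne_right_iff.mp h).1)
      (fun _ h => (ite_ne_right_iff.mp h).1) x y (hweight (hα₁ x hx)) (hweight (hα₁ _ hx'))
      (hweight (hα₂ y hy)) (hweight (hα₂ _ hy'))

theorem exists_bilinearKloostermanBound_lt_one {ε : ℝ} (hε : 0 < ε) {m : ℕ} (hm : 2 ≤ m) :
    ∃ t < 1, BilinearKloostermanBound ε m t := by
  obtain ⟨D, hD₄, hD⟩ := exists_norm_bilinearKloosterman_le_sub hm
  refine ⟨1 - (4 - D) / 9, by linarith, ?_⟩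
  intro N₁ N₂ hN₁ hN₂ _ α₁ α₂ hα₁ hα₂ a ha
  have hhalf (N : ℕ) (hN : (m : ℝ) ^ ε ≤ N) : (N / 3 : ℝ) ≤ (N / 2 : ℕ) := by
    have hN₁ : 1 < N := by
      exact_mod_cast (Real.one_lt_rpow (Nat.one_lt_cast.mpr hm) hε).trans_le hN
    have hthree : N ≤ N / 2 * 3 := by lia
    rw [div_le_iff₀ three_pos]
    exact_mod_cast hthree
  calc ‖bilinearKloosterman m a α₁ α₂ N₁ N₂‖
      ≤ N₁ * N₂ - (N₁ / 2 : ℕ) * ((N₂ / 2 : ℕ) * (4 - D)) := hD N₁ N₂ α₁ α₂ hα₁ hα₂ a ha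
    _ ≤ N₁ * N₂ - (N₁ / 3 : ℝ) * ((N₂ / 3 : ℝ) * (4 - D)) := by
        have : 0 ≤ 4 - D := by linarith
        gcongr
        · exact hhalf N₁ hN₁
        · exact hhalf N₂ hN₂
    _ = (1 - (4 - D) / 9) * (N₁ * N₂) := by ring

lemma exists_forall_exists_lt_rpow_neg {T : ℕ → Set ℝ} {C c : ℝ} (hc : 0 < c)
    (hpower : ∀ m : ℕ, 2 ≤ m → C * (m : ℝ) ^ (-c) ∈ T m)
    (hlt : ∀ m : ℕ, 2 ≤ m → ∃ t ∈ T m, t < 1) :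
    ∃ δ : ℝ, 0 < δ ∧ ∀ m : ℕ, 2 ≤ m → ∃ t ∈ T m, t < (m : ℝ) ^ (-δ) := by
  have hlarge : ∀ᶠ m : ℕ in Filter.atTop, C < (m : ℝ) ^ (c / 2) :=
    ((tendsto_rpow_atTop (half_pos hc)).comp
      tendsto_natCast_atTop_atTop).eventually_gt_atTop C
  obtain ⟨m₀, hm₀⟩ := Filter.eventually_atTop.mp hlarge
  have hsmall : ∀ᶠ δ : ℝ in 𝓝[>] 0, ∀ m ∈ Ico 2 m₀, ∃ t ∈ T m, t < (m : ℝ) ^ (-δ) := by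
    refine (Filter.eventually_all_finset _).mpr fun m hm => ?_
    have hm₂ := (mem_Ico.mp hm).1
    obtain ⟨t, ht, ht₁⟩ := hlt m hm₂
    have hm_pos : (0 : ℝ) < m := by exact_mod_cast two_pos.trans_le hm₂
    have hlim : Filter.Tendsto (fun δ : ℝ => (m : ℝ) ^ (-δ)) (𝓝[>] 0) (𝓝 1) := by
      have hcont : Continuous fun δ : ℝ => (m : ℝ) ^ (-δ) :=
        (Real.continuous_const_rpow hm_pos.ne').comp continuous_neg
      exact tendsto_nhdsWithin_of_tendsto_nhds (by simpa using hcont.tendsto 0)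
    filter_upwards [hlim.eventually_const_lt ht₁] with δ hδ using ⟨t, ht, hδ⟩
  obtain ⟨δ, hδ, hδ_pos, hδ_le⟩ :=
    (hsmall.and (Ioc_mem_nhdsGT (half_pos hc))).exists
  refine ⟨δ, hδ_pos, fun m hm => ?_⟩
  obtain hmm₀ | hmm₀ := lt_or_ge m m₀
  · exact hδ m (mem_Ico.mpr ⟨hm, hmm₀⟩)
  · have hm₁ : (1 : ℝ) ≤ m := by exact_mod_cast one_le_two.trans hm
    refine ⟨_, hpower m hm, ?_⟩
    calc C * (m : ℝ) ^ (-c) < (m : ℝ) ^ (c / 2) * (m : ℝ) ^ (-c) := by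
          gcongr
          exact hm₀ m hmm₀
      _ = (m : ℝ) ^ (-(c / 2)) := by
          rw [← Real.rpow_add (by positivity)]
          ring_nf
      _ ≤ (m : ℝ) ^ (-δ) := by gcongr

theorem corollary1 (ε : ℝ) (hε : 0 < ε) :
    ∃ δ : ℝ, 0 < δ ∧
      ∀ m : ℕ, 2 ≤ m →
      ∀ N₁ N₂ : ℕ, (m : ℝ) ^ ε ≤ (N₁ : ℝ) → (m : ℝ) ^ ε ≤ (N₂ : ℝ) →
        ((N₁ : ℝ) ∉ criticalWindows m ε ∨ (N₂ : ℝ) ∉ criticalWindows m ε) →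
      ∀ α₁ α₂ : ℕ → ℂ,
        (∀ x ∈ Finset.Icc 1 N₁, ‖α₁ x‖ ≤ 1) → (∀ x ∈ Finset.Icc 1 N₂, ‖α₂ x‖ ≤ 1) →
      ∀ a : ℤ, IsCoprime a (m : ℤ) →
        ‖bilinearKloosterman m a α₁ α₂ N₁ N₂‖ < (m : ℝ) ^ (-δ) * (N₁ : ℝ) * (N₂ : ℝ) := by
  obtain ⟨C, c, hc, hpower⟩ := exists_bilinearKloostermanBound_rpow hε
  obtain ⟨δ, hδ, hbound⟩ := exists_forall_exists_lt_rpow_neg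
    (T := fun m => {t | BilinearKloostermanBound ε m t}) hc hpower fun m hm =>
      (exists_bilinearKloostermanBound_lt_one hε hm).imp fun _ => And.symm
  refine ⟨δ, hδ, fun m hm N₁ N₂ hN₁ hN₂ hwindow α₁ α₂ hα₁ hα₂ a ha => ?_⟩
  obtain ⟨t, ht, htδ⟩ := hbound m hm
  have hm_pos : (0 : ℝ) < m := by exact_mod_cast two_pos.trans_le hm
  have hlength : 0 < (m : ℝ) ^ ε := Real.rpow_pos_of_pos hm_pos ε
  calc ‖bilinearKloosterman m a α₁ α₂ N₁ N₂‖
      ≤ t * (N₁ * N₂) := ht N₁ N₂ hN₁ hN₂ hwindow α₁ α₂ hα₁ hα₂ a ha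
    _ < (m : ℝ) ^ (-δ) * (N₁ * N₂) := by
        have := hlength.trans_le hN₁
        have := hlength.trans_le hN₂
        gcongr
    _ = (m : ℝ) ^ (-δ) * N₁ * N₂ := (mul_assoc _ _ _).symm
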